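/- Let $m\ge 1$ and let $(\overline M^{m+1},\overline g)$ be a smooth Lorentzian manifold (signature $(-,+,\dots,+)$) carrying a smooth vector field $\overline X$ that is timelike, $\overline g(\overline X,\overline X)<0$ everywhere, and conformal, $\mathcal L_{\overline X}\overline g=2\eta\,\overline g$ with $\eta\in C^\infty(\overline M)$, $\eta>0$ everywhere. Put $\alpha=\sqrt{-\overline g(\overline X,\overline X)}$ and $\mathcal H=\eta/\alpha$. Let $M^m$ be a compact smooth manifold (without boundary) and $\psi:M\to\overline M$ a smooth spacelike immersion, that is, $g=\psi^*\overline g$ is a Riemannian metric. Let $N$ be the future-pointing unit normal of $\psi$, i.e. the unique normal field along $\psi$ with $\overline g(N,N)=-1$ and $\overline g(N,\overline X)<0$. Let $\overline\nabla$, $\nabla$ be the Levi-Civita connections of $\overline g$, $g$, let $\mathrm{II}(V,W)=\overline\nabla_V W-\nabla_V W$ be the second fundamental form, $\mathbf H=\frac1m\operatorname{trace}_g\mathrm{II}$ the mean curvature vector, and $H=-\overline g(\mathbf H,N)$ the mean curvature function in the direction of $N$. If $H\ge \mathcal H\circ\psi$ on $M$, then $\overline X$ is orthogonal to $\psi$ at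 every point, i.e. $\overline g(\overline X_{\psi(p)},\mathrm d\psi_p v)=0$ for all $p\in M$ and $v\in T_pM$, and $H=\mathcal H\circ\psi$ on $M$. -/

import Mathlib

open scoped Manifold ContDiff

noncomputable section

namespace SpacelikeHypersurface

/-- The model vector space `ℝⁿ` of an `n`-dimensional manifold. -/
abbrev Model (n : ℕ) : Type := EuclideanSpace ℝ (Fin n)

section Metric

variable {n : ℕ} {M : Type*} [TopologicalSpace M] [ChartedSpace (Model n) M]

/-- A field of bilinear forms on the tangent spaces of an `n`-manifold `M`, i.e. a (not yet
smooth or symmetric) covariant `2`-tensor field. -/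
abbrev BilinField (n : ℕ) (M : Type*) [TopologicalSpace M] [ChartedSpace (Model n) M] : Type _ :=
  ∀ x : M, TangentSpace (𝓡 n) x →L[ℝ] TangentSpace (𝓡 n) x →L[ℝ] ℝ

/-- A vector field on `M`. -/
abbrev VField (n : ℕ) (M : Type*) [TopologicalSpace M] [ChartedSpace (Model n) M] : Type _ :=
  ∀ x : M, TangentSpace (𝓡 n) x

/-- `V` is smooth in a neighbourhood of `x`. -/
def VField.SmoothAt [IsManifold (𝓡 n) ∞ M] (V : VField n M) (x : M) : Prop :=
  ContMDiffAt (𝓡 n) (𝓡 n).tangent ∞ (fun y ↦ (⟨y, V y⟩ : TangentBundle (𝓡 n) M)) x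

/-- `g` is a Lorentzian metric (signature `(-,+,…,+)`): smooth, symmetric, and each tangent space
contains a vector `v` with `g(v,v) < 0` on whose orthogonal complement `g` is positive definite. -/
structure IsLorentzianMetric [IsManifold (𝓡 n) ∞ M] (g : BilinField n M) : Prop where
  smooth : ContMDiff (𝓡 n) ((𝓡 n).prod 𝓘(ℝ, Model n →L[ℝ] Model n →L[ℝ] ℝ)) ∞
    (fun x ↦ Bundle.TotalSpace.mk' (Model n →L[ℝ] Model n →L[ℝ] ℝ)
      (E := fun x : M ↦ TangentSpace (𝓡 n) x →L[ℝ] TangentSpace (𝓡 n) x →L[ℝ] ℝ) x (g x))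
  symm : ∀ (x : M) (v w : TangentSpace (𝓡 n) x), g x v w = g x w v
  signature : ∀ x : M, ∃ v : TangentSpace (𝓡 n) x, g x v v < 0 ∧
    ∀ w : TangentSpace (𝓡 n) x, g x v w = 0 → w ≠ 0 → 0 < g x w w

/-- The Lie derivative of `g` along `X`, evaluated on vector fields `V`, `W`:
`(𝓛_X g)(V, W) = X(g(V, W)) - g([X, V], W) - g(V, [X, W])`. -/
def lieDerivMetric (g : BilinField n M) (X V W : VField n M) (x : M) : ℝ :=
  mvfderiv (𝓡 n) (fun y ↦ g y (V y) (W y)) x (X x)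
    - g x (VectorField.mlieBracket (𝓡 n) X V x) (W x)
    - g x (V x) (VectorField.mlieBracket (𝓡 n) X W x)

/-- `𝓛_X g = 2 η g`, tested on all local smooth vector fields. -/
def IsConformalField [IsManifold (𝓡 n) ∞ M] (g : BilinField n M) (X : VField n M)
    (η : M → ℝ) : Prop :=
  ∀ (x : M) (V W : VField n M), V.SmoothAt x → W.SmoothAt x →
    lieDerivMetric g X V W x = 2 * η x * g x (V x) (W x)

/-- The matrix of `g` in the preferred chart around `q`, as a function of the coordinates `y`: the
pullback of `g` by the inverse of the chart. -/
def coordMetric (g : BilinField n M) (q : M) (y : Model n) : Model n →L[ℝ] Model n →L[ℝ] ℝ :=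
  ContinuousLinearMap.bilinearComp (E := Model n) (F := Model n)
    (g ((extChartAt (𝓡 n) q).symm y))
    (mfderiv 𝓘(ℝ, Model n) (𝓡 n) (extChartAt (𝓡 n) q).symm y)
    (mfderiv 𝓘(ℝ, Model n) (𝓡 n) (extChartAt (𝓡 n) q).symm y)

theorem coordMetric_apply (g : BilinField n M) (q : M) (y u v : Model n) :
    coordMetric g q y u v = g ((extChartAt (𝓡 n) q).symm y)
      (mfderiv 𝓘(ℝ, Model n) (𝓡 n) (extChartAt (𝓡 n) q).symm y u)
      (mfderiv 𝓘(ℝ, Model n) (𝓡 n) (extChartAt (𝓡 n) q).symm y v) :=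
  rfl

end Metric

/-- The Christoffel symbols of a metric `G` on (an open subset of) `ℝⁿ`: `Γ_y(u, v)` is the vector
with `G_y(Γ_y(u, v), w) = ½ (∂_u G(v, w) + ∂_v G(u, w) - ∂_w G(u, v))` for all `w`. -/
def christoffel {n : ℕ} (G : Model n → Model n →L[ℝ] Model n →L[ℝ] ℝ) (y u v : Model n) :
    Model n :=
  (G y).inverse ((1 / 2 : ℝ) •
    (fderiv ℝ G y u v + fderiv ℝ G y v u - ((fderiv ℝ G y).flip u).flip v))

section Connection

variable {m n : ℕ} {M : Type*} [TopologicalSpace M] [ChartedSpace (Model m) M]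
  {N : Type*} [TopologicalSpace N] [ChartedSpace (Model n) N]

/-- The Levi-Civita covariant derivative `∇_v Y` at `p`, for the metric `g` on `N`, of a vector
field `Y` along a map `ψ : M → N`, in the direction `v ∈ T_p M`. In coordinates of `N` around
`ψ p` it is `∂_v Y + Γ(dψ v, Y)`. -/
def covDerivAlong (g : BilinField n N) (ψ : M → N) (Y : ∀ p : M, TangentSpace (𝓡 n) (ψ p))
    (p : M) (v : TangentSpace (𝓡 m) p) : TangentSpace (𝓡 n) (ψ p) :=
  let φ : N → Model n := extChartAt (𝓡 n) (ψ p)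
  let Yc : M → Model n := fun p' ↦ mvfderiv (𝓡 n) φ (ψ p') (Y p')
  let ψc : M → Model n := fun p' ↦ φ (ψ p')
  let dYc : Model n := mvfderiv (𝓡 m) Yc p v
  let dψc : Model n := mvfderiv (𝓡 m) ψc p v
  (mvfderiv (𝓡 n) φ (ψ p)).inverse
    (dYc + christoffel (coordMetric g (ψ p)) (ψc p) dψc (Yc p))

/-- The Levi-Civita covariant derivative `∇_v W` at `p` of a vector field `W` on `M`. -/
def covDeriv (g : BilinField m M) (W : VField m M) (p : M) (v : TangentSpace (𝓡 m) p) :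
    TangentSpace (𝓡 m) p :=
  covDerivAlong g (fun p : M ↦ p) W p v

/-- The differential `dψ_p : T_p M → T_{ψ p} N`. -/
abbrev diff (m n : ℕ) {M : Type*} [TopologicalSpace M] [ChartedSpace (Model m) M]
    {N : Type*} [TopologicalSpace N] [ChartedSpace (Model n) N] (ψ : M → N) (p : M) : TangentSpace (𝓡 m) p →L[ℝ] TangentSpace (𝓡 n) (ψ p) :=
  mfderiv (𝓡 m) (𝓡 n) ψ p

/-- The induced metric `ψ^* g`. -/
def inducedMetric (g : BilinField n N) (ψ : M → N) : BilinField m M := fun p ↦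
  ContinuousLinearMap.bilinearComp (E := Model n) (F := Model n) (E' := Model m) (F' := Model m)
    (g (ψ p)) (diff m n ψ p) (diff m n ψ p)

theorem inducedMetric_apply (g : BilinField n N) (ψ : M → N) (p : M)
    (v w : TangentSpace (𝓡 m) p) :
    inducedMetric g ψ p v w = g (ψ p) (diff m n ψ p v) (diff m n ψ p w) :=
  rfl

/-- `ψ` is a smooth spacelike immersion: smooth, with `ψ^* g` positive definite
(which forces every `dψ_p` to be injective). -/
structure IsSpacelikeImmersion (m : ℕ) {M : Type*} [TopologicalSpace M]
    [ChartedSpace (Model m) M] (g : BilinField n N) (ψ : M → N) : Prop where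
  smooth : ContMDiff (𝓡 m) (𝓡 n) ∞ ψ
  spacelike : ∀ (p : M) (v : TangentSpace (𝓡 m) p), v ≠ 0 → 0 < inducedMetric g ψ p v v

/-- The second fundamental form `II(v, w) = ∇̄_v (dψ W) - dψ (∇_v W)`, where `∇̄` is the
Levi-Civita connection of the ambient metric, `∇` that of the induced metric, and `W` is a local
extension of `w` to a smooth vector field (the result does not depend on it). -/
def secondFundamentalForm [IsManifold (𝓡 m) ∞ M] (g : BilinField n N) (ψ : M → N) (p : M)
    (v w : TangentSpace (𝓡 m) p) : TangentSpace (𝓡 n) (ψ p) :=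
  let W : VField m M := FiberBundle.extend (Model m) w
  covDerivAlong g ψ (fun p' ↦ diff m n ψ p' (W p')) p v
    - diff m n ψ p (covDeriv (inducedMetric g ψ) W p v)

/-- The basis of `T_p M` given by the coordinate vectors of the preferred chart at `p`. -/
def coordVec (p : M) (i : Fin m) : TangentSpace (𝓡 m) p :=
  (EuclideanSpace.single i (1 : ℝ) : Model m)

/-- The trace `∑ᵢⱼ gⁱʲ B(∂ᵢ, ∂ⱼ)` of a bilinear map `B` on `T_p M` with respect to `g`; it equals
`∑ᵢ B(eᵢ, eᵢ)` for every `g`-orthonormal basis `(eᵢ)` when `g` is positive definite. -/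
def metricTrace (g : BilinField m M) (p : M) {F : Type*} [AddCommGroup F] [Module ℝ F]
    (B : TangentSpace (𝓡 m) p → TangentSpace (𝓡 m) p → F) : F :=
  ∑ i, ∑ j, (Matrix.of fun k l ↦ g p (coordVec p k) (coordVec p l))⁻¹ i j •
    B (coordVec p i) (coordVec p j)

/-- The mean curvature vector `(1/m) tr_{ψ^* g} II`, where `m = dim M`. -/
def meanCurvatureVector [IsManifold (𝓡 m) ∞ M] (g : BilinField n N) (ψ : M → N) (p : M) :
    TangentSpace (𝓡 n) (ψ p) :=
  (1 / (m : ℝ)) • metricTrace (inducedMetric g ψ) p (secondFundamentalForm (m := m) g ψ p)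

/-- `ν` is a unit timelike normal vector of `ψ` at `p` with the same time-orientation as `X`. -/
structure IsFutureUnitNormal (m : ℕ) {M : Type*} [TopologicalSpace M]
    [ChartedSpace (Model m) M] (g : BilinField n N) (X : VField n N) (ψ : M → N) (p : M)
    (ν : TangentSpace (𝓡 n) (ψ p)) : Prop where
  normal : ∀ v : TangentSpace (𝓡 m) p, g (ψ p) ν (diff m n ψ p v) = 0
  unit : g (ψ p) ν ν = -1
  future : g (ψ p) ν (X (ψ p)) < 0

end Connection

/-- Linear algebra: in a vector space of dimension `m + 1` with a symmetric bilinear form `b` and a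
vector `x` with `b(x, x) < 0`, an `m`-dimensional subspace (the image of `f`) on which `b` is
positive definite has exactly one unit normal `ν` with `b(ν, ν) = -1` and `b(ν, x) < 0`. -/
theorem existsUnique_unit_normal {m : ℕ} {T E : Type*} [AddCommGroup T] [Module ℝ T]
    [AddCommGroup E] [Module ℝ E] (hT : Module.finrank ℝ T = m) (hE : Module.finrank ℝ E = m + 1)
    [FiniteDimensional ℝ T] [FiniteDimensional ℝ E] (b : E →ₗ[ℝ] E →ₗ[ℝ] ℝ)
    (hb : ∀ v w, b v w = b w v) (f : T →ₗ[ℝ] E) (hf : ∀ v, v ≠ 0 → 0 < b (f v) (f v))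
    (x : E) (hx : b x x < 0) :
    ∃! ν : E, (∀ v, b ν (f v) = 0) ∧ b ν ν = -1 ∧ b ν x < 0 := by
  have hinj : Function.Injective f := by
    rw [injective_iff_map_eq_zero]
    intro v hv
    by_contra h
    have := hf v h
    simp [hv] at this
  let B : T →ₗ[ℝ] Module.Dual ℝ T := b.compl₁₂ f f
  have hBinj : Function.Injective B := by
    rw [injective_iff_map_eq_zero]
    intro v hv
    by_contra h
    have h1 := hf v h
    have h2 : B v v = 0 := by rw [hv]; rfl
    simp only [B, LinearMap.compl₁₂_apply] at h2
    linarith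
  have hBsurj : Function.Surjective B :=
    (LinearMap.injective_iff_surjective_of_finrank_eq_finrank
      (Subspace.dual_finrank_eq (K := ℝ) (V := T)).symm).1 hBinj
  obtain ⟨t, ht⟩ := hBsurj ((b x).comp f)
  have ht' : ∀ v, b (f t) (f v) = b x (f v) := fun v ↦ by
    have := LinearMap.congr_fun ht v
    simpa [B] using this
  have hpos : 0 ≤ b (f t) (f t) := by
    by_cases h : t = 0
    · simp [h]
    · exact (hf t h).le
  set y := x - f t with hy
  have hyT : ∀ v, b y (f v) = 0 := fun v ↦ by simp [hy, ht']
  have hyx : b y x = b y y := by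
    have : b y y = b y x - b y (f t) := by rw [← map_sub]
    rw [this, hyT, sub_zero]
  have hyy : b y y < 0 := by
    have h1 : b y x = b x x - b (f t) x := by simp [hy]
    rw [← hyx, h1, hb (f t) x, ← ht' t]
    linarith
  set s := Real.sqrt (-b y y) with hs
  have hs2 : s * s = -b y y := Real.mul_self_sqrt (by linarith)
  have hs0 : 0 < s := Real.sqrt_pos.2 (by linarith)
  have hunit : b (s⁻¹ • y) (s⁻¹ • y) = -1 := by
    have h1 : b y y = -(s * s) := by linarith
    simp only [map_smul, LinearMap.smul_apply, smul_eq_mul, h1]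
    field_simp
  refine ⟨s⁻¹ • y, ⟨fun v ↦ by simp [hyT], hunit, ?_⟩, ?_⟩
  · simp only [map_smul, LinearMap.smul_apply, smul_eq_mul, hyx]
    exact mul_neg_of_pos_of_neg (inv_pos.2 hs0) hyy
  rintro ν ⟨h1, h2, h3⟩
  have hrange : Module.finrank ℝ (LinearMap.range f) = m := by
    rw [LinearMap.finrank_range_of_inj hinj, hT]
  have hynot : y ∉ LinearMap.range f := by
    rintro ⟨v, hv⟩
    have := hyT v
    rw [hv] at this
    linarith
  have htop : LinearMap.range f ⊔ Submodule.span ℝ {y} = ⊤ := by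
    apply Submodule.eq_top_of_finrank_eq
    have hlt : LinearMap.range f < LinearMap.range f ⊔ Submodule.span ℝ {y} := by
      refine lt_of_le_of_ne le_sup_left fun h ↦ hynot ?_
      rw [h]
      exact Submodule.mem_sup_right (Submodule.mem_span_singleton_self y)
    have := Submodule.finrank_lt_finrank_of_lt hlt
    have h' := Submodule.finrank_le (LinearMap.range f ⊔ Submodule.span ℝ {y})
    omega
  have hν : ν ∈ LinearMap.range f ⊔ Submodule.span ℝ {y} := htop ▸ Submodule.mem_top
  obtain ⟨_, ⟨v, rfl⟩, _, hz, hvz⟩ := Submodule.mem_sup.1 hν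
  obtain ⟨c, rfl⟩ := Submodule.mem_span_singleton.1 hz
  have hv0 : v = 0 := by
    by_contra h
    have h4 := hf v h
    have h5 := h1 v
    rw [← hvz] at h5
    simp [hyT] at h5
    linarith
  have hνc : ν = c • y := by rw [← hvz, hv0]; simp
  subst hνc
  simp only [map_smul, LinearMap.smul_apply, smul_eq_mul, hyx] at h2 h3
  have hc : 0 < c := by
    by_contra h
    have := mul_nonneg_of_nonpos_of_nonpos (not_lt.1 h) hyy.le
    linarith
  have hcs : (c * s) * (c * s) = 1 * 1 := by
    have : c * s * (c * s) = c * c * (s * s) := by ring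
    rw [this, hs2]
    linarith
  have hcs1 : c * s = 1 := (mul_self_inj (by positivity) zero_le_one).1 hcs
  rw [eq_inv_of_mul_eq_one_left hcs1]

section Hypersurface

variable {m : ℕ} {M : Type*} [TopologicalSpace M] [ChartedSpace (Model m) M]
  {N : Type*} [TopologicalSpace N] [ChartedSpace (Model (m + 1)) N]

/-- A spacelike hypersurface has exactly one future-pointing unit normal at every point. -/
theorem existsUnique_futureUnitNormal [IsManifold (𝓡 (m + 1)) ∞ N]
    {g : BilinField (m + 1) N} (hg : IsLorentzianMetric g) {X : VField (m + 1) N}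
    (hX : ∀ x, g x (X x) (X x) < 0) {ψ : M → N} (hψ : IsSpacelikeImmersion m g ψ) (p : M) :
    ∃! ν : TangentSpace (𝓡 (m + 1)) (ψ p), IsFutureUnitNormal m g X ψ p ν := by
  have hf : ∀ v : TangentSpace (𝓡 m) p, v ≠ 0 → 0 < g (ψ p) (diff m (m + 1) ψ p v)
      (diff m (m + 1) ψ p v) := fun v hv ↦ hψ.spacelike p v hv
  have hT : Module.finrank ℝ (TangentSpace (𝓡 m) p) = m :=
    finrank_euclideanSpace_fin (𝕜 := ℝ) (n := m)
  have hE : Module.finrank ℝ (TangentSpace (𝓡 (m + 1)) (ψ p)) = m + 1 :=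
    finrank_euclideanSpace_fin (𝕜 := ℝ) (n := m + 1)
  have : FiniteDimensional ℝ (TangentSpace (𝓡 m) p) :=
    inferInstanceAs (FiniteDimensional ℝ (Model m))
  have : FiniteDimensional ℝ (TangentSpace (𝓡 (m + 1)) (ψ p)) :=
    inferInstanceAs (FiniteDimensional ℝ (Model (m + 1)))
  obtain ⟨ν, ⟨h1, h2, h3⟩, h4⟩ := existsUnique_unit_normal hT hE (ContinuousLinearMap.toLinearMap₁₂ (g (ψ p)))
    (hg.symm (ψ p)) (diff m (m + 1) ψ p).toLinearMap hf (X (ψ p)) (hX (ψ p))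
  exact ⟨ν, ⟨h1, h2, h3⟩, fun ν' h ↦ h4 ν' ⟨h.normal, h.unit, h.future⟩⟩

/-- The future-pointing unit normal of a spacelike hypersurface. -/
def futureUnitNormal (m : ℕ) {M : Type*} [TopologicalSpace M] [ChartedSpace (Model m) M]
    {N : Type*} [TopologicalSpace N] [ChartedSpace (Model (m + 1)) N]
    (g : BilinField (m + 1) N) (X : VField (m + 1) N) (ψ : M → N) (p : M) :
    TangentSpace (𝓡 (m + 1)) (ψ p) :=
  Classical.epsilon (IsFutureUnitNormal m g X ψ p)

theorem futureUnitNormal_spec [IsManifold (𝓡 (m + 1)) ∞ N]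
    {g : BilinField (m + 1) N} (hg : IsLorentzianMetric g) {X : VField (m + 1) N}
    (hX : ∀ x, g x (X x) (X x) < 0) {ψ : M → N} (hψ : IsSpacelikeImmersion m g ψ) (p : M) :
    IsFutureUnitNormal m g X ψ p (futureUnitNormal m g X ψ p) :=
  Classical.epsilon_spec (existsUnique_futureUnitNormal hg hX hψ p).exists

/-- The mean curvature function `H = -g(𝐇, N)` in the direction of the future-pointing unit
normal `N`, so that `𝐇 = H N`. -/
def meanCurvature [IsManifold (𝓡 m) ∞ M] (g : BilinField (m + 1) N) (X : VField (m + 1) N) (ψ : M → N) (p : M) : ℝ :=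
  -g (ψ p) (meanCurvatureVector (m := m) g ψ p) (futureUnitNormal m g X ψ p)

end Hypersurface

end SpacelikeHypersurface

end

/-!
Let `T` be the tangential part of `X` along `ψ`, i.e. the vector field on `M` with
`g(T, v) = ḡ(X, dψ v)` for all `v`. Restricting the conformal equation `𝓛_X ḡ = 2 η ḡ` to `M` gives
`𝓛_T g = 2 η g + 2 ḡ(II, X)`, and half of the trace of this identity is
`div T = m (η + ḡ(𝐇, X))`. Writing `X = dψ T + a N` with `a = -ḡ(X, N) > 0`, and using that `𝐇` is
normal, this becomes `div T = m (η - H a)`. Since `α² = -ḡ(X, X) = a² - |T|²`, we have `a ≥ α`, so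
that `H ≥ η / α > 0` yields `H a ≥ η` and `div T ≤ 0`. On the compact manifold `M` the integral of
`div T` vanishes, hence `div T = 0` and `H a = η ≤ H α`. Thus `a ≤ α`, which forces `T = 0`: `X` is
normal, `a = α` and `H = η / α`.

All of this is carried out in the preferred charts. The divergence of a vector field is defined as
half of the trace of the Lie derivative of the metric (`coordDiv`), which makes its independence of
the chart immediate from the naturality of the Lie derivative (`lieTensor_pullback`), while
Jacobi's formula for the derivative of a determinant turns it into the classical expression
`(1/√G) ∑ⱼ ∂ⱼ(√G tʲ)` (`sum_fderiv_density_mul`). Integration by parts in a chart and a smooth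
partition of unity then give `divergence_eq_zero`: a vector field on a compact Riemannian manifold
whose divergence is nonpositive is divergence free. No Riemannian measure on `M` is constructed:
only integrals of functions supported in one chart occur, and the change of variables formula shows
that they do not depend on the chart. Orientability is not needed. The identity for `𝓛_T g` is
`lieTensor_tangentialPart`, and its trace is `divergence_tangentialPart`.
-/

open scoped Matrix Topology
open MeasureTheory

noncomputable section

namespace SpacelikeHypersurface

/-! ### Bilinear forms on `ℝᵐ` and their traces -/

section LinearAlgebra

variable {m n : ℕ}

/-- The Gram matrix of a bilinear form on `ℝᵐ` in the standard basis. -/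
def gram (B : Model m →L[ℝ] Model m →L[ℝ] ℝ) : Matrix (Fin m) (Fin m) ℝ :=
  LinearMap.toMatrix₂ (EuclideanSpace.basisFun (Fin m) ℝ).toBasis
    (EuclideanSpace.basisFun (Fin m) ℝ).toBasis (ContinuousLinearMap.toLinearMap₁₂ B)

theorem gram_apply (B : Model m →L[ℝ] Model m →L[ℝ] ℝ) (i j : Fin m) :
    gram B i j = B (EuclideanSpace.single i 1) (EuclideanSpace.single j 1) := by
  simp [gram, LinearMap.toMatrix₂_apply]

/-- The matrix of an endomorphism of `ℝᵐ` in the standard basis. -/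
def stdMatrix (J : Model m →L[ℝ] Model m) : Matrix (Fin m) (Fin m) ℝ :=
  LinearMap.toMatrix (EuclideanSpace.basisFun (Fin m) ℝ).toBasis
    (EuclideanSpace.basisFun (Fin m) ℝ).toBasis J.toLinearMap

theorem stdMatrix_apply (J : Model m →L[ℝ] Model m) (i j : Fin m) :
    stdMatrix J i j = J (EuclideanSpace.single j 1) i := by
  simp [stdMatrix, LinearMap.toMatrix_apply]

theorem det_stdMatrix (J : Model m →L[ℝ] Model m) : (stdMatrix J).det = J.det := by
  rw [stdMatrix, LinearMap.det_toMatrix]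

theorem gram_bilinearComp (B : Model m →L[ℝ] Model m →L[ℝ] ℝ) (J K : Model m →L[ℝ] Model m) :
    gram (B.bilinearComp J K) = (stdMatrix J)ᵀ * gram B * stdMatrix K := by
  rw [gram, gram, stdMatrix, stdMatrix, ← LinearMap.toMatrix₂_compl₁₂]
  rfl

theorem stdMatrix_id : stdMatrix (ContinuousLinearMap.id ℝ (Model m)) = 1 := by
  ext i j
  simp [stdMatrix_apply, Matrix.one_apply]

theorem gram_add (B C : Model m →L[ℝ] Model m →L[ℝ] ℝ) : gram (B + C) = gram B + gram C := by
  ext i j; simp [gram_apply]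

theorem gram_smul (c : ℝ) (B : Model m →L[ℝ] Model m →L[ℝ] ℝ) : gram (c • B) = c • gram B := by
  ext i j; simp [gram_apply]

/-- The trace of the bilinear form `C` with respect to the metric `B`. The transpose makes the sum
`bilinTrace_eq_sum` hold without any symmetry of `B` or `C`. -/
def bilinTrace (B C : Model m →L[ℝ] Model m →L[ℝ] ℝ) : ℝ :=
  ((gram B)⁻¹ * (gram C)ᵀ).trace

theorem bilinTrace_eq_sum (B C : Model m →L[ℝ] Model m →L[ℝ] ℝ) :
    bilinTrace B C = ∑ i, ∑ j, (gram B)⁻¹ i j *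
      C (EuclideanSpace.single i 1) (EuclideanSpace.single j 1) := by
  simp [bilinTrace, Matrix.trace, Matrix.mul_apply, gram_apply]

theorem bilinTrace_bilinearComp (B C : Model m →L[ℝ] Model m →L[ℝ] ℝ) {J : Model m →L[ℝ] Model m}
    (hJ : J.det ≠ 0) :
    bilinTrace (B.bilinearComp J J) (C.bilinearComp J J) = bilinTrace B C := by
  have hu : IsUnit (stdMatrix J).det := by rw [det_stdMatrix]; exact hJ.isUnit
  have hut : IsUnit (stdMatrix J)ᵀ.det := by rwa [Matrix.det_transpose]
  simp only [bilinTrace, gram_bilinearComp, Matrix.mul_inv_rev, Matrix.transpose_mul,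
    Matrix.transpose_transpose]
  rw [show (stdMatrix J)⁻¹ * ((gram B)⁻¹ * (stdMatrix J)ᵀ⁻¹) *
      ((stdMatrix J)ᵀ * ((gram C)ᵀ * stdMatrix J)) = (stdMatrix J)⁻¹ * ((gram B)⁻¹ *
      ((stdMatrix J)ᵀ⁻¹ * (stdMatrix J)ᵀ) * (gram C)ᵀ * stdMatrix J) by
        simp only [Matrix.mul_assoc], Matrix.nonsing_inv_mul _ hut, Matrix.mul_one,
    Matrix.trace_mul_comm, Matrix.mul_assoc _ (stdMatrix J), Matrix.mul_nonsing_inv _ hu,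
    Matrix.mul_one]

/-- `B` is an inner product: a bilinear form on `ℝᵐ` that is symmetric and positive definite. -/
structure IsInner (B : Model m →L[ℝ] Model m →L[ℝ] ℝ) : Prop where
  symm : ∀ u v, B u v = B v u
  pos : ∀ u, u ≠ 0 → 0 < B u u

theorem isInvertible_of_nondegenerate {B : Model m →L[ℝ] Model m →L[ℝ] ℝ}
    (h : ∀ u, (∀ v, B u v = 0) → u = 0) : B.IsInvertible := by
  have hinj : Function.Injective B.toLinearMap := by
    rw [injective_iff_map_eq_zero]
    intro u hu
    exact h u fun v ↦ by
      change B.toLinearMap u v = 0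
      rw [hu]; rfl
  have hfin : Module.finrank ℝ (Model m) = Module.finrank ℝ (Model m →L[ℝ] ℝ) := by
    rw [← (LinearMap.toContinuousLinearMap : (Model m →ₗ[ℝ] ℝ) ≃ₗ[ℝ] _).finrank_eq]
    exact (Subspace.dual_finrank_eq (K := ℝ) (V := Model m)).symm
  exact ⟨(LinearEquiv.ofInjectiveOfFinrankEq B.toLinearMap hinj hfin).toContinuousLinearEquiv,
    by ext; rfl⟩

theorem IsInner.isInvertible {B : Model m →L[ℝ] Model m →L[ℝ] ℝ} (hB : IsInner B) :
    B.IsInvertible := by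
  refine isInvertible_of_nondegenerate fun u hu ↦ ?_
  by_contra h
  exact (hB.pos u h).ne' (hu u)

theorem apply_inverse_apply {B : Model m →L[ℝ] Model m →L[ℝ] ℝ} (hB : B.IsInvertible)
    (l : Model m →L[ℝ] ℝ) (v : Model m) : B (B.inverse l) v = l v := by
  rw [← (hB.inverse_apply_eq (x := B.inverse l)).1 rfl]

theorem IsInner.posDef_gram {B : Model m →L[ℝ] Model m →L[ℝ] ℝ} (hB : IsInner B) :
    (gram B).PosDef := by
  refine Matrix.PosDef.of_dotProduct_mulVec_pos ?_ fun x hx ↦ ?_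
  · ext i j
    simp [gram_apply, hB.symm]
  · have hpos := hB.pos (WithLp.toLp 2 x) (by simpa using hx)
    have hsum : WithLp.toLp 2 x = ∑ i, x i • (EuclideanSpace.single i (1 : ℝ) : Model m) := by
      ext j
      simp [Pi.single_apply]
    rw [hsum] at hpos
    simp only [map_sum, map_smul, sum_apply, smul_apply,
      smul_eq_mul] at hpos
    refine hpos.trans_eq ?_
    simp only [dotProduct, Matrix.mulVec, gram_apply, Finset.mul_sum, star_trivial]
    rw [Finset.sum_comm]
    exact Finset.sum_congr rfl fun i _ ↦ Finset.sum_congr rfl fun j _ ↦ by ring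

end LinearAlgebra

/-! ### Jacobi's formula -/

section Jacobi

variable {m : ℕ}

theorem differentiable_det : Differentiable ℝ (fun A : Fin m → Fin m → ℝ ↦ (Matrix.of A).det) := by
  simp only [Matrix.det_apply, Matrix.of_apply]
  fun_prop

/-- Jacobi's formula for the directional derivative of the determinant at an invertible matrix. -/
theorem fderiv_det_apply (A H : Fin m → Fin m → ℝ) (hA : (Matrix.of A).det ≠ 0) :
    fderiv ℝ (fun A : Fin m → Fin m → ℝ ↦ (Matrix.of A).det) A H =
      (Matrix.of A).det * ((Matrix.of A)⁻¹ * Matrix.of H).trace := by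
  have h1 : HasDerivAt (fun s : ℝ ↦ (Matrix.of (A + s • H)).det)
      (fderiv ℝ (fun A : Fin m → Fin m → ℝ ↦ (Matrix.of A).det) A H) 0 := by
    have h2 : HasDerivAt (fun s : ℝ ↦ A + s • H) H 0 := by
      simpa using ((hasDerivAt_id (0 : ℝ)).smul_const H).const_add A
    have h3 := (differentiable_det (A + (0 : ℝ) • H)).hasFDerivAt.comp_hasDerivAt (0 : ℝ) h2
    rw [zero_smul, add_zero] at h3
    exact h3
  have h4 : HasDerivAt (fun s : ℝ ↦ (Matrix.of (A + s • H)).det)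
      ((Matrix.of A).det * ((Matrix.of A)⁻¹ * Matrix.of H).trace) 0 := by
    have h5 : (fun s : ℝ ↦ (Matrix.of (A + s • H)).det) = fun s : ℝ ↦ (Matrix.of A).det *
        ((1 + Polynomial.X (R := ℝ) • ((Matrix.of A)⁻¹ * Matrix.of H).map Polynomial.C).det).eval
          s := by
      funext s
      have h6 : Matrix.of (A + s • H) =
          Matrix.of A * (1 + s • ((Matrix.of A)⁻¹ * Matrix.of H)) := by
        rw [Matrix.mul_add, Matrix.mul_one, Matrix.mul_smul, ← Matrix.mul_assoc,
          Matrix.mul_nonsing_inv _ hA.isUnit, Matrix.one_mul]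
        rfl
      rw [h6, Matrix.det_mul, ← Polynomial.coe_evalRingHom, RingHom.map_det]
      generalize (Matrix.of A)⁻¹ * Matrix.of H = P
      congr 2
      ext i j
      simp [Matrix.one_apply, apply_ite]
      ring
    rw [h5, ← Matrix.derivative_det_one_add_X_smul]
    exact (Polynomial.hasDerivAt _ _).const_mul _
  exact h1.unique h4

end Jacobi

/-! ### Lie derivative, divergence and volume density in coordinates -/

section Divergence

variable {m n : ℕ}

/-- The Lie derivative `𝓛_t G` of a metric `G` on (an open subset of) `ℝᵐ` along the vector field
`t`, at the point `y`: `(𝓛_t G)(u, v) = ∂_t G(u, v) + G(∂_u t, v) + G(u, ∂_v t)`. -/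
def lieTensor (G : Model m → Model m →L[ℝ] Model m →L[ℝ] ℝ) (t : Model m → Model m)
    (y : Model m) : Model m →L[ℝ] Model m →L[ℝ] ℝ :=
  fderiv ℝ G y (t y) + (G y).bilinearComp (fderiv ℝ t y) (ContinuousLinearMap.id ℝ _)
    + (G y).bilinearComp (ContinuousLinearMap.id ℝ _) (fderiv ℝ t y)

theorem lieTensor_apply (G : Model m → Model m →L[ℝ] Model m →L[ℝ] ℝ) (t : Model m → Model m)
    (y u v : Model m) :
    lieTensor G t y u v =
      fderiv ℝ G y (t y) u v + G y (fderiv ℝ t y u) v + G y u (fderiv ℝ t y v) :=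
  rfl

/-- The Riemannian divergence of the vector field `t` for the metric `G` on (an open subset of)
`ℝᵐ`, defined as half of the trace of `𝓛_t G`. -/
def coordDiv (G : Model m → Model m →L[ℝ] Model m →L[ℝ] ℝ) (t : Model m → Model m)
    (y : Model m) : ℝ :=
  1 / 2 * bilinTrace (G y) (lieTensor G t y)

/-- The Riemannian volume density `√(det G)`. -/
def density (G : Model m → Model m →L[ℝ] Model m →L[ℝ] ℝ) (y : Model m) : ℝ :=
  √(gram (G y)).det

theorem IsInner.density_pos {G : Model m → Model m →L[ℝ] Model m →L[ℝ] ℝ} {y : Model m}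
    (h : IsInner (G y)) : 0 < density G y :=
  Real.sqrt_pos.2 h.posDef_gram.det_pos

theorem IsInner.gram_transpose {B : Model m →L[ℝ] Model m →L[ℝ] ℝ} (h : IsInner B) :
    (gram B)ᵀ = gram B := by
  ext i j
  simp [gram_apply, h.symm]

/-- The trace of `𝓛_t G`, split into the contributions of the derivatives of `G` and of `t`. -/
theorem coordDiv_eq {G : Model m → Model m →L[ℝ] Model m →L[ℝ] ℝ} {t : Model m → Model m}
    {y : Model m} (h : IsInner (G y)) :
    coordDiv G t y = 1 / 2 * ((gram (G y))⁻¹ * gram (fderiv ℝ G y (t y))).trace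
      + (stdMatrix (fderiv ℝ t y)).trace := by
  have hs := h.gram_transpose
  have hu : IsUnit (gram (G y)).det := h.posDef_gram.det_pos.ne'.isUnit
  have h1 : ((gram (G y))⁻¹ * (gram (fderiv ℝ G y (t y)))ᵀ).trace =
      ((gram (G y))⁻¹ * gram (fderiv ℝ G y (t y))).trace := by
    rw [← Matrix.trace_transpose, Matrix.transpose_mul, Matrix.transpose_transpose,
      Matrix.transpose_nonsing_inv, hs, Matrix.trace_mul_comm]
  simp only [coordDiv, bilinTrace, lieTensor, gram_add, gram_bilinearComp, stdMatrix_id,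
    Matrix.transpose_add, Matrix.mul_add, Matrix.trace_add, h1, Matrix.transpose_mul,
    Matrix.transpose_transpose, Matrix.transpose_one, Matrix.one_mul, Matrix.mul_one, hs]
  rw [← Matrix.mul_assoc, Matrix.nonsing_inv_mul _ hu, Matrix.one_mul,
    Matrix.trace_mul_comm _ ((stdMatrix _)ᵀ * _), Matrix.mul_assoc, Matrix.mul_nonsing_inv _ hu,
    Matrix.mul_one, Matrix.trace_transpose]
  ring

/-- `√(det G)` is differentiable, with logarithmic derivative `½ tr(G⁻¹ ∂G)`. -/
theorem differentiableAt_density {G : Model m → Model m →L[ℝ] Model m →L[ℝ] ℝ} {y : Model m}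
    (h : IsInner (G y)) (hG : DifferentiableAt ℝ G y) :
    DifferentiableAt ℝ (density G) y ∧ ∀ w, fderiv ℝ (density G) y w =
      density G y * (1 / 2 * ((gram (G y))⁻¹ * gram (fderiv ℝ G y w)).trace) := by
  have hdet := h.posDef_gram.det_pos
  let A : Model m → Fin m → Fin m → ℝ := fun z i j ↦ gram (G z) i j
  let A' : Model m →L[ℝ] Fin m → Fin m → ℝ := ContinuousLinearMap.pi fun i ↦
    ContinuousLinearMap.pi fun j ↦
      ((fderiv ℝ G y).flip (EuclideanSpace.single i 1)).flip (EuclideanSpace.single j 1)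
  have hA : HasFDerivAt A A' y := by
    refine hasFDerivAt_pi.2 fun i ↦ hasFDerivAt_pi.2 fun j ↦ ?_
    have h1 := (hG.hasFDerivAt.clm_apply
      (hasFDerivAt_const (EuclideanSpace.single i (1 : ℝ)) y)).clm_apply
      (hasFDerivAt_const (EuclideanSpace.single j (1 : ℝ)) y)
    simp only [gram_apply]
    refine h1.congr_fderiv ?_
    ext w
    simp
  have hD : HasFDerivAt (fun z ↦ (gram (G z)).det) _ y :=
    (differentiable_det (A y)).hasFDerivAt.comp y hA
  have hS := hD.sqrt hdet.ne'
  refine ⟨hS.differentiableAt, fun w ↦ ?_⟩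
  have hAy : Matrix.of (A y) = gram (G y) := rfl
  have hw : Matrix.of (A' w) = gram (fderiv ℝ G y w) := by
    ext i j
    simp [A', gram_apply]
  have h2 := fderiv_det_apply (A y) (A' w) hdet.ne'
  rw [hAy, hw] at h2
  change fderiv ℝ (fun z ↦ √(gram (G z)).det) y w = _
  rw [hS.fderiv, smul_apply, ContinuousLinearMap.comp_apply, h2, density]
  have hsq : √(gram (G y)).det * √(gram (G y)).det = (gram (G y)).det :=
    Real.mul_self_sqrt hdet.le
  have hpos : 0 < √(gram (G y)).det := Real.sqrt_pos.2 hdet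
  rw [smul_eq_mul]
  nth_rewrite 2 [← hsq]
  field_simp

/-- The classical formula `√G div t = ∑ⱼ ∂ⱼ(√G tʲ)`, with a function `f` multiplied in. -/
theorem sum_fderiv_density_mul {G : Model m → Model m →L[ℝ] Model m →L[ℝ] ℝ}
    {t : Model m → Model m} {f : Model m → ℝ} {y : Model m} (h : IsInner (G y))
    (hG : DifferentiableAt ℝ G y) (ht : DifferentiableAt ℝ t y) (hf : DifferentiableAt ℝ f y) :
    ∑ j, fderiv ℝ (fun z ↦ f z * (density G z * t z j)) y (EuclideanSpace.single j 1) =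
      (f y * coordDiv G t y + fderiv ℝ f y (t y)) * density G y := by
  obtain ⟨hd, hd'⟩ := differentiableAt_density h hG
  have htj : ∀ j, HasFDerivAt (fun z ↦ t z j)
      ((EuclideanSpace.proj j : Model m →L[ℝ] ℝ).comp (fderiv ℝ t y)) y := fun j ↦
    (EuclideanSpace.proj j : Model m →L[ℝ] ℝ).hasFDerivAt.comp y ht.hasFDerivAt
  have hj : ∀ j, fderiv ℝ (fun z ↦ f z * (density G z * t z j)) y (EuclideanSpace.single j 1) =
      f y * (density G y * stdMatrix (fderiv ℝ t y) j j +
        t y j * fderiv ℝ (density G) y (EuclideanSpace.single j 1))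
      + density G y * (t y j * fderiv ℝ f y (EuclideanSpace.single j 1)) := fun j ↦ by
    have h1 : HasFDerivAt (fun z ↦ f z * (density G z * t z j)) _ y :=
      hf.hasFDerivAt.mul (hd.hasFDerivAt.mul (htj j))
    rw [h1.fderiv, stdMatrix_apply]
    simp
    ring
  have hsum : ∀ L : Model m →L[ℝ] ℝ, ∑ j, t y j * L (EuclideanSpace.single j 1) = L (t y) := by
    intro L
    have : t y = ∑ j, t y j • (EuclideanSpace.single j (1 : ℝ) : Model m) := by
      ext i
      simp [Pi.single_apply]
    conv_rhs => rw [this]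
    simp
  simp only [hj, Finset.sum_add_distrib, ← Finset.mul_sum, hsum]
  rw [hd', coordDiv_eq h, show ∑ j, stdMatrix (fderiv ℝ t y) j j =
    (stdMatrix (fderiv ℝ t y)).trace from rfl]
  ring

end Divergence

/-! ### Naturality under changes of coordinates -/

section ChangeOfCoordinates

variable {m n : ℕ}

theorem hasFDerivAt_fderiv {h : Model m → Model n} {y : Model m} (hh : ContDiffAt ℝ ∞ h y) :
    HasFDerivAt (fderiv ℝ h) (fderiv ℝ (fderiv ℝ h) y) y :=
  ((hh.fderiv_right (m := 1) (WithTop.coe_le_coe.2 (le_top (a := (1 + 1 : ℕ∞))))).differentiableAt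
    (by simp)).hasFDerivAt

theorem fderiv_fderiv_symm {h : Model m → Model n} {y : Model m} (hh : ContDiffAt ℝ ∞ h y)
    (u v : Model m) : fderiv ℝ (fderiv ℝ h) y u v = fderiv ℝ (fderiv ℝ h) y v u :=
  hh.isSymmSndFDerivAt (by simpa using WithTop.coe_le_coe.2 (le_top (a := (2 : ℕ∞)))) u v

/-- The product rule for `z ↦ B z (a z) (b z)`. -/
theorem exists_hasFDerivAt_bilin {B : Model m → Model n →L[ℝ] Model n →L[ℝ] ℝ}
    {B' : Model m →L[ℝ] Model n →L[ℝ] Model n →L[ℝ] ℝ} {a b : Model m → Model n}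
    {a' b' : Model m →L[ℝ] Model n} {y : Model m} (hB : HasFDerivAt B B' y)
    (ha : HasFDerivAt a a' y) (hb : HasFDerivAt b b' y) :
    ∃ L : Model m →L[ℝ] ℝ, HasFDerivAt (fun z ↦ B z (a z) (b z)) L y ∧
      ∀ w, L w = B' w (a y) (b y) + B y (a' w) (b y) + B y (a y) (b' w) := by
  refine ⟨_, (hB.clm_apply ha).clm_apply hb, fun w ↦ ?_⟩
  simp only [add_apply, ContinuousLinearMap.comp_apply, ContinuousLinearMap.flip_apply]
  ring

/-- Two expressions `B z (a z) (b z)` that agree near `y` have the same derivative at `y`. -/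
theorem bilin_deriv_congr {k : ℕ} {B : Model m → Model n →L[ℝ] Model n →L[ℝ] ℝ}
    {B' : Model m →L[ℝ] Model n →L[ℝ] Model n →L[ℝ] ℝ} {a b : Model m → Model n}
    {a' b' : Model m →L[ℝ] Model n} {y : Model m} (hB : HasFDerivAt B B' y)
    (ha : HasFDerivAt a a' y) (hb : HasFDerivAt b b' y)
    {C : Model m → Model k →L[ℝ] Model k →L[ℝ] ℝ}
    {C' : Model m →L[ℝ] Model k →L[ℝ] Model k →L[ℝ] ℝ} {c d : Model m → Model k}
    {c' d' : Model m →L[ℝ] Model k} (hC : HasFDerivAt C C' y)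
    (hc : HasFDerivAt c c' y) (hd : HasFDerivAt d d' y)
    (h : ∀ᶠ z in 𝓝 y, B z (a z) (b z) = C z (c z) (d z)) (w : Model m) :
    B' w (a y) (b y) + B y (a' w) (b y) + B y (a y) (b' w) =
      C' w (c y) (d y) + C y (c' w) (d y) + C y (c y) (d' w) := by
  obtain ⟨L, hL, hL'⟩ := exists_hasFDerivAt_bilin hB ha hb
  obtain ⟨K, hK, hK'⟩ := exists_hasFDerivAt_bilin hC hc hd
  rw [← hL', ← hK', hL.unique (hK.congr_of_eventuallyEq h)]

theorem hasFDerivAt_fderiv_apply {h : Model m → Model n} {y : Model m} (hh : ContDiffAt ℝ ∞ h y)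
    (u : Model m) :
    HasFDerivAt (fun z ↦ fderiv ℝ h z u) ((fderiv ℝ (fderiv ℝ h) y).flip u) y := by
  refine ((hasFDerivAt_fderiv hh).clm_apply (hasFDerivAt_const u y)).congr_fderiv ?_
  ext w
  simp

/-- The derivative of a pulled back bilinear form. -/
theorem fderiv_pullback_apply {G : Model m → Model m →L[ℝ] Model m →L[ℝ] ℝ}
    {B : Model n → Model n →L[ℝ] Model n →L[ℝ] ℝ} {h : Model m → Model n} {y : Model m}
    (hG : ∀ᶠ z in 𝓝 y, ∀ u v, G z u v = B (h z) (fderiv ℝ h z u) (fderiv ℝ h z v))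
    (hGd : DifferentiableAt ℝ G y) (hB : DifferentiableAt ℝ B (h y)) (hh : ContDiffAt ℝ ∞ h y)
    (w u v : Model m) :
    fderiv ℝ G y w u v = fderiv ℝ B (h y) (fderiv ℝ h y w) (fderiv ℝ h y u) (fderiv ℝ h y v)
      + B (h y) (fderiv ℝ (fderiv ℝ h) y w u) (fderiv ℝ h y v)
      + B (h y) (fderiv ℝ h y u) (fderiv ℝ (fderiv ℝ h) y w v) := by
  have hd : HasFDerivAt h (fderiv ℝ h y) y := (hh.differentiableAt (by simp)).hasFDerivAt
  have hBh : HasFDerivAt (fun z ↦ B (h z)) ((fderiv ℝ B (h y)).comp (fderiv ℝ h y)) y :=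
    HasFDerivAt.comp (g := B) (f := h) y hB.hasFDerivAt hd
  have h1 := bilin_deriv_congr hGd.hasFDerivAt (hasFDerivAt_const u y) (hasFDerivAt_const v y)
    hBh (hasFDerivAt_fderiv_apply hh u) (hasFDerivAt_fderiv_apply hh v)
    (hG.mono fun z hz ↦ hz u v) w
  simpa only [zero_apply, map_zero, add_zero, ContinuousLinearMap.comp_apply,
    ContinuousLinearMap.flip_apply, Function.comp_apply] using h1

/-- The Lie derivative of a metric is natural under changes of coordinates. -/
theorem lieTensor_pullback {G B : Model m → Model m →L[ℝ] Model m →L[ℝ] ℝ}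
    {h t s : Model m → Model m} {y : Model m}
    (hG : ∀ᶠ z in 𝓝 y, ∀ u v, G z u v = B (h z) (fderiv ℝ h z u) (fderiv ℝ h z v))
    (hts : ∀ᶠ z in 𝓝 y, fderiv ℝ h z (t z) = s (h z))
    (hGd : DifferentiableAt ℝ G y) (hB : DifferentiableAt ℝ B (h y)) (hh : ContDiffAt ℝ ∞ h y)
    (ht : DifferentiableAt ℝ t y) (hs : DifferentiableAt ℝ s (h y)) :
    lieTensor G t y = (lieTensor B s (h y)).bilinearComp (fderiv ℝ h y) (fderiv ℝ h y) := by
  have hd : HasFDerivAt h (fderiv ℝ h y) y := (hh.differentiableAt (by simp)).hasFDerivAt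
  have hdd : HasFDerivAt (fderiv ℝ h) (fderiv ℝ (fderiv ℝ h) y) y :=
    hasFDerivAt_fderiv hh
  have hsymm : ∀ u v, fderiv ℝ (fderiv ℝ h) y u v = fderiv ℝ (fderiv ℝ h) y v u :=
    fderiv_fderiv_symm hh
  have h1 := (hdd.clm_apply ht.hasFDerivAt).unique
    ((hs.hasFDerivAt.comp y hd).congr_of_eventuallyEq hts)
  have h2 : ∀ u, fderiv ℝ h y (fderiv ℝ t y u) =
      fderiv ℝ s (h y) (fderiv ℝ h y u) - fderiv ℝ (fderiv ℝ h) y (t y) u := fun u ↦ by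
    have := congrArg (fun L : Model m →L[ℝ] Model m ↦ L u) h1
    simp only [add_apply, ContinuousLinearMap.comp_apply, ContinuousLinearMap.flip_apply] at this
    rw [hsymm (t y) u, ← this]
    abel
  ext u v
  have h3 := hG.self_of_nhds
  have h4 := hts.self_of_nhds
  rw [lieTensor_apply, fderiv_pullback_apply hG hGd hB hh, h3, h3, h2, h2, h4,
    ContinuousLinearMap.bilinearComp_apply, lieTensor_apply]
  simp only [map_sub, sub_apply]
  ring

/-- The divergence does not depend on the coordinates. -/
theorem coordDiv_pullback {G B : Model m → Model m →L[ℝ] Model m →L[ℝ] ℝ}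
    {h t s : Model m → Model m} {y : Model m}
    (hG : ∀ᶠ z in 𝓝 y, ∀ u v, G z u v = B (h z) (fderiv ℝ h z u) (fderiv ℝ h z v))
    (hts : ∀ᶠ z in 𝓝 y, fderiv ℝ h z (t z) = s (h z))
    (hGd : DifferentiableAt ℝ G y) (hB : DifferentiableAt ℝ B (h y)) (hh : ContDiffAt ℝ ∞ h y)
    (ht : DifferentiableAt ℝ t y) (hs : DifferentiableAt ℝ s (h y))
    (hdet : (fderiv ℝ h y).det ≠ 0) :
    coordDiv G t y = coordDiv B s (h y) := by
  have hG0 : G y = (B (h y)).bilinearComp (fderiv ℝ h y) (fderiv ℝ h y) := by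
    ext u v
    exact hG.self_of_nhds u v
  rw [coordDiv, coordDiv, lieTensor_pullback hG hts hGd hB hh ht hs, hG0,
    bilinTrace_bilinearComp _ _ hdet]

/-- The volume density transforms with the absolute value of the Jacobian determinant. -/
theorem density_pullback {G B : Model m → Model m →L[ℝ] Model m →L[ℝ] ℝ} {y z : Model m}
    {J : Model m →L[ℝ] Model m} (hG : ∀ u v, G y u v = B z (J u) (J v)) :
    density G y = |J.det| * density B z := by
  have hG0 : G y = (B z).bilinearComp J J := by
    ext u v
    exact hG u v
  rw [density, density, hG0, gram_bilinearComp, Matrix.det_mul, Matrix.det_mul,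
    Matrix.det_transpose, det_stdMatrix, mul_right_comm, Real.sqrt_mul (mul_self_nonneg _),
    Real.sqrt_mul_self_eq_abs]

end ChangeOfCoordinates

/-! ### The second fundamental form in coordinates -/

section Immersion

variable {m n : ℕ}

/-- The Koszul formula that characterizes the Christoffel symbols of a nondegenerate metric. -/
theorem christoffel_spec {G : Model m → Model m →L[ℝ] Model m →L[ℝ] ℝ} {y : Model m}
    (hG : (G y).IsInvertible) (u v w : Model m) :
    G y (christoffel G y u v) w =
      1 / 2 * (fderiv ℝ G y u v w + fderiv ℝ G y v u w - fderiv ℝ G y w u v) := by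
  rw [christoffel, apply_inverse_apply hG]
  simp

/-- The second fundamental form, in coordinates, of an immersion `h` that pulls the metric `B`
back to `G`: the second derivative of `h`, corrected by the Christoffel symbols of `B` and of
`G`. -/
def coordII (G : Model m → Model m →L[ℝ] Model m →L[ℝ] ℝ)
    (B : Model n → Model n →L[ℝ] Model n →L[ℝ] ℝ) (h : Model m → Model n) (y u v : Model m) :
    Model n :=
  fderiv ℝ (fderiv ℝ h) y u v + christoffel B (h y) (fderiv ℝ h y u) (fderiv ℝ h y v)
    - fderiv ℝ h y (christoffel G y u v)

/-- The second fundamental form takes normal values. -/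
theorem coordII_normal {G : Model m → Model m →L[ℝ] Model m →L[ℝ] ℝ}
    {B : Model n → Model n →L[ℝ] Model n →L[ℝ] ℝ} {h : Model m → Model n} {y : Model m}
    (hG : ∀ᶠ z in 𝓝 y, ∀ u v, G z u v = B (h z) (fderiv ℝ h z u) (fderiv ℝ h z v))
    (hGd : DifferentiableAt ℝ G y) (hB : DifferentiableAt ℝ B (h y)) (hh : ContDiffAt ℝ ∞ h y)
    (hsymm : ∀ z u v, B z u v = B z v u)
    (hGi : (G y).IsInvertible) (hBi : (B (h y)).IsInvertible) (u v w : Model m) :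
    B (h y) (coordII G B h y u v) (fderiv ℝ h y w) = 0 := by
  have hs : ∀ u v, fderiv ℝ (fderiv ℝ h) y u v = fderiv ℝ (fderiv ℝ h) y v u :=
    fderiv_fderiv_symm hh
  -- both Koszul formulas are compared after expressing the derivatives of `G` by those of `B`, `h`
  have h1 := christoffel_spec hGi u v w
  have h2 := christoffel_spec hBi (fderiv ℝ h y u) (fderiv ℝ h y v) (fderiv ℝ h y w)
  simp only [fderiv_pullback_apply hG hGd hB hh, hG.self_of_nhds] at h1
  simp only [coordII, map_sub, map_add, add_apply, sub_apply]
  rw [h2, h1, hsymm _ (fderiv ℝ h y v) (fderiv ℝ (fderiv ℝ h) y u w),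
    hsymm _ (fderiv ℝ h y u) (fderiv ℝ (fderiv ℝ h) y v w), hs v u, hs w u, hs w v,
    hsymm _ (fderiv ℝ h y u) (fderiv ℝ (fderiv ℝ h) y v w)]
  ring

/-- If `X` is conformal for `B` with factor `c`, then the `B`-tangential part `t` of `X` along an
immersion `h` satisfies `𝓛_t G = 2 c G + 2 B(X, II)`. The proof symmetrizes the derivative of the
one-form `G(t, ·) = B(X, dh ·)` and rewrites the derivatives of `G` and `B` by Koszul's formula. -/
theorem lieTensor_tangentialPart {G : Model m → Model m →L[ℝ] Model m →L[ℝ] ℝ}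
    {B : Model n → Model n →L[ℝ] Model n →L[ℝ] ℝ} {h : Model m → Model n} {y : Model m}
    {t : Model m → Model m} {X : Model n → Model n} {c : ℝ}
    (hG : ∀ᶠ z in 𝓝 y, ∀ u v, G z u v = B (h z) (fderiv ℝ h z u) (fderiv ℝ h z v))
    (ht : ∀ᶠ z in 𝓝 y, ∀ v, G z (t z) v = B (h z) (X (h z)) (fderiv ℝ h z v))
    (hX : ∀ u v, lieTensor B X (h y) u v = 2 * c * B (h y) u v)
    (hGd : DifferentiableAt ℝ G y) (hB : DifferentiableAt ℝ B (h y)) (hh : ContDiffAt ℝ ∞ h y)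
    (htd : DifferentiableAt ℝ t y) (hXd : DifferentiableAt ℝ X (h y))
    (hsymm : ∀ z u v, B z u v = B z v u)
    (hGi : (G y).IsInvertible) (hBi : (B (h y)).IsInvertible) (u v : Model m) :
    lieTensor G t y u v = 2 * c * G y u v + 2 * B (h y) (coordII G B h y u v) (X (h y)) := by
  have hd : HasFDerivAt h (fderiv ℝ h y) y := (hh.differentiableAt (by simp)).hasFDerivAt
  have hdd : HasFDerivAt (fderiv ℝ h) (fderiv ℝ (fderiv ℝ h) y) y :=
    hasFDerivAt_fderiv hh
  have hs : ∀ u v, fderiv ℝ (fderiv ℝ h) y u v = fderiv ℝ (fderiv ℝ h) y v u :=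
    fderiv_fderiv_symm hh
  have hBh : HasFDerivAt (fun z ↦ B (h z)) ((fderiv ℝ B (h y)).comp (fderiv ℝ h y)) y :=
    HasFDerivAt.comp (g := B) (f := h) y hB.hasFDerivAt hd
  -- the differential of the one-form `G(t, ·) = B(X, dh ·)`
  have key : ∀ u v, fderiv ℝ G y u (t y) v + G y (fderiv ℝ t y u) v =
      fderiv ℝ B (h y) (fderiv ℝ h y u) (X (h y)) (fderiv ℝ h y v)
      + B (h y) (fderiv ℝ X (h y) (fderiv ℝ h y u)) (fderiv ℝ h y v)
      + B (h y) (X (h y)) (fderiv ℝ (fderiv ℝ h) y u v) := fun u v ↦ by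
    have h1 := bilin_deriv_congr hGd.hasFDerivAt htd.hasFDerivAt (hasFDerivAt_const v y)
      hBh (hXd.hasFDerivAt.comp y hd) (hasFDerivAt_fderiv_apply hh v)
      (ht.mono fun z hz ↦ hz v) u
    simpa only [zero_apply, map_zero, add_zero, ContinuousLinearMap.comp_apply,
      ContinuousLinearMap.flip_apply, Function.comp_apply] using h1
  have hGsymm : ∀ u v, G y u v = G y v u := fun u v ↦ by
    rw [hG.self_of_nhds, hG.self_of_nhds, hsymm]
  have hGfsymm : ∀ w u v, fderiv ℝ G y w u v = fderiv ℝ G y w v u := fun w u v ↦ by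
    have hev : ∀ᶠ z in 𝓝 y, G z u v = G z v u := hG.mono fun z hz ↦ by rw [hz, hz, hsymm]
    have h1 := bilin_deriv_congr hGd.hasFDerivAt (hasFDerivAt_const u y) (hasFDerivAt_const v y)
      hGd.hasFDerivAt (hasFDerivAt_const v y) (hasFDerivAt_const u y) hev w
    simpa only [zero_apply, map_zero, add_zero] using h1
  have hBfsymm : ∀ w u v, fderiv ℝ B (h y) w u v = fderiv ℝ B (h y) w v u := fun w u v ↦ by
    have h1 := bilin_deriv_congr hB.hasFDerivAt (hasFDerivAt_const u (h y))
      (hasFDerivAt_const v (h y)) hB.hasFDerivAt (hasFDerivAt_const v (h y))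
      (hasFDerivAt_const u (h y)) (.of_forall fun z ↦ hsymm z u v) w
    simpa only [zero_apply, map_zero, add_zero] using h1
  have hX1 := hX (fderiv ℝ h y u) (fderiv ℝ h y v)
  have h1 := christoffel_spec hGi u v (t y)
  have h2 := christoffel_spec hBi (fderiv ℝ h y u) (fderiv ℝ h y v) (X (h y))
  have h3 : G y (christoffel G y u v) (t y) =
      B (h y) (fderiv ℝ h y (christoffel G y u v)) (X (h y)) := by
    rw [hGsymm, ht.self_of_nhds, hsymm]
  have k1 := key u v
  have k2 := key v u
  rw [lieTensor_apply] at hX1 ⊢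
  simp only [coordII, map_sub, map_add, add_apply, sub_apply]
  rw [← h3, h1, h2, hG.self_of_nhds u v, hGsymm u, hGfsymm u v, hGfsymm v u,
    hBfsymm _ (fderiv ℝ h y v) (X _), hBfsymm _ (fderiv ℝ h y u) (X _), hsymm _ _ (X _)]
  rw [hsymm _ (fderiv ℝ h y u) (fderiv ℝ X (h y) _)] at hX1
  rw [hs v u] at k2
  linarith

end Immersion

/-! ### Tensor fields and transition maps in charts -/

section Charts

variable {m n : ℕ} {M : Type*} [TopologicalSpace M] [ChartedSpace (Model m) M]
  [IsManifold (𝓡 m) ∞ M] {N : Type*} [TopologicalSpace N] [ChartedSpace (Model n) N]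
  [IsManifold (𝓡 n) ∞ N]

/-- The differential of the inverse of the preferred chart at `q`, as an endomorphism of `ℝᵐ`
(every tangent space of `M` is the type `ℝᵐ`). -/
def frame (q : M) (y : Model m) : Model m →L[ℝ] Model m :=
  mfderiv 𝓘(ℝ, Model m) (𝓡 m) (extChartAt (𝓡 m) q).symm y

/-- The differential of the preferred chart at `q`, as an endomorphism of `ℝᵐ`. -/
def coframe (q x : M) : Model m →L[ℝ] Model m :=
  mfderiv (𝓡 m) 𝓘(ℝ, Model m) (extChartAt (𝓡 m) q) x

/-- The coordinate expression of the vector field `T` in the preferred chart at `q`, a vector field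
on the target of the chart. -/
def coordField (T : VField m M) (q : M) (y : Model m) : Model m :=
  VectorField.mpullback 𝓘(ℝ, Model m) (𝓡 m) (extChartAt (𝓡 m) q).symm T y

/-- The local vector field with constant components `u` in the preferred chart at `q`. -/
def chartField (q : M) (u : Model m) : VField m M :=
  VectorField.mpullback (𝓡 m) 𝓘(ℝ, Model m) (extChartAt (𝓡 m) q) (fun _ ↦ u)

theorem isInvertible_frame (q : M) {y : Model m} (hy : y ∈ (extChartAt (𝓡 m) q).target) :
    (frame q y).IsInvertible := by
  have : IsManifold (𝓡 m) 1 M := IsManifold.of_le (n := ∞) (by simp)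
  have h := isInvertible_mfderivWithin_extChartAt_symm (I := 𝓡 m) hy
  rw [ModelWithCorners.range_eq_univ, mfderivWithin_univ] at h
  exact h

theorem frame_coordField (T : VField m M) (q : M) {y : Model m}
    (hy : y ∈ (extChartAt (𝓡 m) q).target) :
    frame q y (coordField T q y) = T ((extChartAt (𝓡 m) q).symm y) :=
  (((isInvertible_frame q hy).inverse_apply_eq (x := coordField T q y)).1 rfl).symm

theorem coordField_eq_iff (T : VField m M) (q : M) {y : Model m} {u : Model m}
    (hy : y ∈ (extChartAt (𝓡 m) q).target) :
    coordField T q y = u ↔ (T ((extChartAt (𝓡 m) q).symm y) : Model m) = frame q y u :=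
  (isInvertible_frame q hy).inverse_apply_eq

theorem coframe_frame (q : M) {y : Model m}
    (hy : y ∈ (extChartAt (𝓡 m) q).target) (u : Model m) :
    coframe q ((extChartAt (𝓡 m) q).symm y) (frame q y u) = u := by
  have : IsManifold (𝓡 m) 1 M := IsManifold.of_le (n := ∞) (by simp)
  have h := mfderiv_extChartAt_comp_mfderivWithin_extChartAt_symm (I := 𝓡 m) hy
  rw [ModelWithCorners.range_eq_univ, mfderivWithin_univ] at h
  exact congrArg (fun L : Model m →L[ℝ] Model m ↦ L u) h

theorem chartField_symm (q : M) {y : Model m} (hy : y ∈ (extChartAt (𝓡 m) q).target)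
    (u : Model m) : chartField q u ((extChartAt (𝓡 m) q).symm y) = frame q y u := by
  have : IsManifold (𝓡 m) 1 M := IsManifold.of_le (n := ∞) (by simp)
  have h := isInvertible_mfderiv_extChartAt (I := 𝓡 m) ((extChartAt (𝓡 m) q).map_target hy)
  have h' : (coframe q ((extChartAt (𝓡 m) q).symm y)).IsInvertible := h
  exact (h'.inverse_apply_eq (x := frame q y u)).2 (coframe_frame q hy u).symm

theorem coordField_chartField (q : M) {y : Model m} (hy : y ∈ (extChartAt (𝓡 m) q).target)
    (u : Model m) : coordField (chartField q u) q y = u :=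
  (coordField_eq_iff _ q hy).2 (chartField_symm q hy u)

/-- The tangent space at `q` is identified with `ℝᵐ` through the preferred chart at `q`, whose
differential at `q` is therefore the identity. -/
theorem frame_self (q : M) :
    frame q (extChartAt (𝓡 m) q q) = ContinuousLinearMap.id ℝ (Model m) := by
  have : IsManifold (𝓡 m) 1 M := IsManifold.of_le (n := ∞) (by simp)
  have h := mfderivWithin_range_extChartAt_symm (I := 𝓡 m) (x := q)
  rw [ModelWithCorners.range_eq_univ, mfderivWithin_univ] at h
  exact h

theorem contMDiffAt_extChartAt_symm (q : M) {y : Model m}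
    (hy : y ∈ (extChartAt (𝓡 m) q).target) :
    ContMDiffAt 𝓘(ℝ, Model m) (𝓡 m) ∞ (extChartAt (𝓡 m) q).symm y :=
  (contMDiffOn_extChartAt_symm q).contMDiffAt ((isOpen_extChartAt_target q).mem_nhds hy)

theorem contDiffAt_coordField {T : VField m M} (hT : ∀ x, T.SmoothAt x) (q : M) {y : Model m}
    (hy : y ∈ (extChartAt (𝓡 m) q).target) : ContDiffAt ℝ ∞ (coordField T q) y := by
  have h := ContMDiffAt.mpullback_vectorField_preimage (m := ∞) (n := ∞)
    (hT ((extChartAt (𝓡 m) q).symm y)) (contMDiffAt_extChartAt_symm q hy)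
    (isInvertible_frame q hy) (by simp)
  exact contMDiffAt_vectorSpace_iff_contDiffAt.1 h

theorem smoothAt_chartField (q : M) {x : M} (hx : x ∈ (extChartAt (𝓡 m) q).source) (u : Model m) :
    (chartField q u).SmoothAt x := by
  have : IsManifold (𝓡 m) 1 M := IsManifold.of_le (n := ∞) (by simp)
  have hc : ContMDiffAt 𝓘(ℝ, Model m) (𝓘(ℝ, Model m)).tangent ∞
      (fun y : Model m ↦ (⟨y, u⟩ : TangentBundle 𝓘(ℝ, Model m) (Model m)))
      (extChartAt (𝓡 m) q x) :=
    contMDiffAt_vectorSpace_iff_contDiffAt.2 contDiffAt_const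
  exact ContMDiffAt.mpullback_vectorField_preimage (m := ∞) (n := ∞) hc
    (contMDiffAt_extChartAt' (by simpa using hx))
    (isInvertible_mfderiv_extChartAt (I := 𝓡 m) hx) (by simp)

omit [IsManifold (𝓡 m) ∞ M] in
/-- Evaluation of a field of bilinear forms on equal base points. -/
theorem bilinField_congr (g : BilinField m M) {x x' : M} (h : x = x') (u v : Model m) :
    (g x : Model m →L[ℝ] Model m →L[ℝ] ℝ) u v = (g x' : Model m →L[ℝ] Model m →L[ℝ] ℝ) u v := by
  subst h; rfl

omit [IsManifold (𝓡 m) ∞ M] in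
theorem coordMetric_eq_frame (g : BilinField m M) (q : M) (y u v : Model m) :
    coordMetric g q y u v = (g ((extChartAt (𝓡 m) q).symm y) : Model m →L[ℝ] Model m →L[ℝ] ℝ)
      (frame q y u) (frame q y v) := rfl

/-- A field of bilinear forms that is smooth as a section of the bundle of bilinear forms has
smooth components in the charts. -/
theorem contDiffAt_coordMetric {g : BilinField m M}
    (hg : ContMDiff (𝓡 m) ((𝓡 m).prod 𝓘(ℝ, Model m →L[ℝ] Model m →L[ℝ] ℝ)) ∞
    (fun x ↦ Bundle.TotalSpace.mk' (Model m →L[ℝ] Model m →L[ℝ] ℝ)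
      (E := fun x : M ↦ TangentSpace (𝓡 m) x →L[ℝ] TangentSpace (𝓡 m) x →L[ℝ] ℝ) x (g x)))
    (q : M) {y : Model m} (hy : y ∈ (extChartAt (𝓡 m) q).target) :
    ContDiffAt ℝ ∞ (coordMetric g q) y := by
  suffices h : ContDiffOn ℝ ∞ (coordMetric g q) (extChartAt (𝓡 m) q).target from
    h.contDiffAt ((isOpen_extChartAt_target q).mem_nhds hy)
  refine contDiffOn_clm_apply.2 fun u ↦ contDiffOn_clm_apply.2 fun v y hy ↦
    ContDiffAt.contDiffWithinAt ?_
  have hx := (extChartAt (𝓡 m) q).map_target hy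
  have h1 : ContMDiffAt (𝓡 m) ((𝓡 m).prod 𝓘(ℝ, ℝ)) ∞
      (fun x ↦ Bundle.TotalSpace.mk' ℝ (E := Bundle.Trivial M ℝ) x
        (g x (chartField q u x) (chartField q v x))) ((extChartAt (𝓡 m) q).symm y) :=
    ContMDiffAt.clm_bundle_apply₂ (F₁ := Model m) (F₂ := Model m) (hg _)
      (smoothAt_chartField q hx u) (smoothAt_chartField q hx v)
  have h2 : ContMDiffAt (𝓡 m) 𝓘(ℝ, ℝ) ∞ (fun x ↦ g x (chartField q u x) (chartField q v x))
      ((extChartAt (𝓡 m) q).symm y) := by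
    exact (Bundle.contMDiffAt_totalSpace.1 h1).2
  have h3 := (h2.comp y (contMDiffAt_extChartAt_symm q hy)).contDiffAt
  refine h3.congr_of_eventuallyEq ?_
  filter_upwards [(isOpen_extChartAt_target q).mem_nhds hy] with z hz
  rw [coordMetric_eq_frame, ← chartField_symm q hz, ← chartField_symm q hz]
  rfl

/-- A map into `N`, written in a chart: its differential is the frame applied to the derivative of
the coordinate expression. -/
theorem mfderiv_eq_frame_comp {k : ℕ} {f : Model k → N} {y : Model k} (Q : N)
    (hf : ContMDiffAt 𝓘(ℝ, Model k) (𝓡 n) ∞ f y) (hy : f y ∈ (extChartAt (𝓡 n) Q).source)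
    (v : Model k) :
    ((mfderiv 𝓘(ℝ, Model k) (𝓡 n) f y : Model k →L[ℝ] Model n) v) =
      frame Q (extChartAt (𝓡 n) Q (f y)) (fderiv ℝ (fun z ↦ extChartAt (𝓡 n) Q (f z)) y v) := by
  have hy' := (extChartAt (𝓡 n) Q).map_source hy
  have hh : ContMDiffAt 𝓘(ℝ, Model k) 𝓘(ℝ, Model n) ∞ (fun z ↦ extChartAt (𝓡 n) Q (f z)) y :=
    (contMDiffAt_extChartAt' (by simpa using hy)).comp y hf
  have heq : f =ᶠ[𝓝 y] (extChartAt (𝓡 n) Q).symm ∘ (fun z ↦ extChartAt (𝓡 n) Q (f z)) := by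
    filter_upwards [hf.continuousAt.preimage_mem_nhds
      ((isOpen_extChartAt_source Q).mem_nhds hy)] with z hz
    exact ((extChartAt (𝓡 n) Q).left_inv hz).symm
  have h1 := mfderiv_comp y ((contMDiffAt_extChartAt_symm Q hy').mdifferentiableAt (by simp))
    (hh.mdifferentiableAt (by simp))
  have h2 := congrArg (fun L : Model k →L[ℝ] Model n ↦ L v) (heq.mfderiv_eq.trans h1)
  rw [mfderiv_eq_fderiv] at h2
  exact h2

/-- Pulling a field of bilinear forms back by a map, computed in a chart of the target. -/
theorem pullback_eq_coordMetric {k : ℕ} {f : Model k → N} {y : Model k} (g : BilinField n N) (Q : N)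
    (hf : ContMDiffAt 𝓘(ℝ, Model k) (𝓡 n) ∞ f y) (hy : f y ∈ (extChartAt (𝓡 n) Q).source)
    (u v : Model k) :
    (g (f y) : Model n →L[ℝ] Model n →L[ℝ] ℝ)
      ((mfderiv 𝓘(ℝ, Model k) (𝓡 n) f y : Model k →L[ℝ] Model n) u)
      ((mfderiv 𝓘(ℝ, Model k) (𝓡 n) f y : Model k →L[ℝ] Model n) v) =
    coordMetric g Q (extChartAt (𝓡 n) Q (f y))
      (fderiv ℝ (fun z ↦ extChartAt (𝓡 n) Q (f z)) y u)
      (fderiv ℝ (fun z ↦ extChartAt (𝓡 n) Q (f z)) y v) := by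
  rw [coordMetric_eq_frame, mfderiv_eq_frame_comp Q hf hy, mfderiv_eq_frame_comp Q hf hy]
  exact bilinField_congr g ((extChartAt (𝓡 n) Q).left_inv hy).symm _ _

omit [IsManifold (𝓡 m) ∞ M] in
theorem vField_congr (X : VField m M) {x x' : M} (h : x = x') :
    (X x : Model m) = (X x' : Model m) := by
  subst h; rfl

/-- Pairing a vector field with the differential of a map, computed in a chart of the target. -/
theorem pullback_form_eq_coordMetric {k : ℕ} {f : Model k → N} {y : Model k} (g : BilinField n N)
    (X : VField n N) (Q : N)
    (hf : ContMDiffAt 𝓘(ℝ, Model k) (𝓡 n) ∞ f y) (hy : f y ∈ (extChartAt (𝓡 n) Q).source)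
    (v : Model k) :
    (g (f y) : Model n →L[ℝ] Model n →L[ℝ] ℝ) (X (f y))
      ((mfderiv 𝓘(ℝ, Model k) (𝓡 n) f y : Model k →L[ℝ] Model n) v) =
    coordMetric g Q (extChartAt (𝓡 n) Q (f y)) (coordField X Q (extChartAt (𝓡 n) Q (f y)))
      (fderiv ℝ (fun z ↦ extChartAt (𝓡 n) Q (f z)) y v) := by
  rw [coordMetric_eq_frame, mfderiv_eq_frame_comp Q hf hy,
    frame_coordField X Q ((extChartAt (𝓡 n) Q).map_source hy),
    vField_congr X ((extChartAt (𝓡 n) Q).left_inv hy)]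
  exact bilinField_congr g ((extChartAt (𝓡 n) Q).left_inv hy).symm _ _

/-- The transition map between the preferred charts at `q` and at `l`. -/
def transition (q l : M) (y : Model m) : Model m :=
  extChartAt (𝓡 m) l ((extChartAt (𝓡 m) q).symm y)

/-- The part of the target of the chart at `q` on which the transition map to `l` is defined. -/
def overlap (q l : M) : Set (Model m) :=
  (extChartAt (𝓡 m) q).target ∩ (extChartAt (𝓡 m) q).symm ⁻¹' (extChartAt (𝓡 m) l).source

omit [IsManifold (𝓡 m) ∞ M] in
theorem isOpen_overlap (q l : M) : IsOpen (overlap q l : Set (Model m)) :=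
  (continuousOn_extChartAt_symm q).isOpen_inter_preimage (isOpen_extChartAt_target q)
    (isOpen_extChartAt_source l)

omit [IsManifold (𝓡 m) ∞ M] in
theorem transition_mem_overlap {q l : M} {y : Model m} (hy : y ∈ overlap q l) :
    transition q l y ∈ overlap l q := by
  refine ⟨(extChartAt (𝓡 m) l).map_source hy.2, ?_⟩
  change (extChartAt (𝓡 m) l).symm (extChartAt (𝓡 m) l _) ∈
    (extChartAt (𝓡 m) q).source
  rw [(extChartAt (𝓡 m) l).left_inv hy.2]
  exact (extChartAt (𝓡 m) q).map_target hy.1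

omit [IsManifold (𝓡 m) ∞ M] in
theorem transition_transition {q l : M} {y : Model m} (hy : y ∈ overlap q l) :
    transition l q (transition q l y) = y := by
  rw [transition, transition, (extChartAt (𝓡 m) l).left_inv hy.2,
    (extChartAt (𝓡 m) q).right_inv hy.1]

omit [IsManifold (𝓡 m) ∞ M] in
theorem symm_transition {q l : M} {y : Model m} (hy : y ∈ overlap q l) :
    (extChartAt (𝓡 m) l).symm (transition q l y) = (extChartAt (𝓡 m) q).symm y :=
  (extChartAt (𝓡 m) l).left_inv hy.2

omit [IsManifold (𝓡 m) ∞ M] in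
theorem transition_image_overlap (q l : M) :
    transition (m := m) q l '' overlap q l = overlap l q := by
  ext z
  constructor
  · rintro ⟨y, hy, rfl⟩
    exact transition_mem_overlap (m := m) hy
  · exact fun hz ↦ ⟨transition (m := m) l q z, transition_mem_overlap hz, transition_transition hz⟩

omit [IsManifold (𝓡 m) ∞ M] in
theorem injOn_transition (q l : M) : Set.InjOn (transition (m := m) q l) (overlap q l) := by
  intro y hy z hz h
  rw [← transition_transition (m := m) hy, h, transition_transition hz]

theorem contDiffAt_transition {q l : M} {y : Model m} (hy : y ∈ overlap q l) :
    ContDiffAt ℝ ∞ (transition q l) y :=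
  ((contMDiffAt_extChartAt' (by simpa using hy.2)).comp y
    (contMDiffAt_extChartAt_symm q hy.1)).contDiffAt

theorem det_fderiv_transition_ne_zero {q l : M} {y : Model m} (hy : y ∈ overlap q l) :
    (fderiv ℝ (transition q l) y).det ≠ 0 := by
  have h1 : HasFDerivAt (transition q l) (fderiv ℝ (transition q l) y) y :=
    ((contDiffAt_transition hy).differentiableAt (by simp)).hasFDerivAt
  have h2 : HasFDerivAt (transition l q) (fderiv ℝ (transition l q) (transition q l y))
      (transition q l y) :=
    ((contDiffAt_transition (transition_mem_overlap hy)).differentiableAt (by simp)).hasFDerivAt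
  have h3 := (h2.comp y h1).unique ((hasFDerivAt_id y).congr_of_eventuallyEq (by
    filter_upwards [(isOpen_overlap q l).mem_nhds hy] with z hz using transition_transition hz))
  intro h0
  have h4 : (fderiv ℝ (transition l q) (transition q l y)).det * (fderiv ℝ (transition q l) y).det
      = 1 := by
    have h5 := LinearMap.det_comp (fderiv ℝ (transition l q) (transition q l y)).toLinearMap
      (fderiv ℝ (transition q l) y).toLinearMap
    rw [← ContinuousLinearMap.toLinearMap_comp, h3] at h5
    simpa [ContinuousLinearMap.det] using h5.symm
  simp [h0] at h4

theorem coordMetric_transition (g : BilinField m M) {q l : M} {y : Model m} (hy : y ∈ overlap q l)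
    (u v : Model m) :
    coordMetric g q y u v = coordMetric g l (transition q l y)
      (fderiv ℝ (transition q l) y u) (fderiv ℝ (transition q l) y v) :=
  pullback_eq_coordMetric g l (contMDiffAt_extChartAt_symm q hy.1) hy.2 u v

theorem frame_transition {q l : M} {y : Model m} (hy : y ∈ overlap q l) (v : Model m) :
    frame q y v = frame l (transition q l y) (fderiv ℝ (transition q l) y v) :=
  mfderiv_eq_frame_comp l (contMDiffAt_extChartAt_symm q hy.1) hy.2 v

theorem coordField_transition (T : VField m M) {q l : M} {y : Model m} (hy : y ∈ overlap q l) :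
    fderiv ℝ (transition q l) y (coordField T q y) = coordField T l (transition q l y) := by
  refine ((coordField_eq_iff T l (transition_mem_overlap hy).1).2 ?_).symm
  rw [← frame_transition hy, frame_coordField T q hy.1]
  exact vField_congr T (symm_transition hy)

end Charts

/-! ### Integration by parts on `ℝᵐ` -/

section Integration

variable {m : ℕ}

/-- The integral of a directional derivative of a compactly supported function vanishes. -/
theorem integral_fderiv_apply_eq_zero {F : Model m → ℝ} (hF : ContDiff ℝ 1 F)
    (hc : HasCompactSupport F) (e : Model m) : ∫ y, fderiv ℝ F y e = 0 := by
  have hint : Integrable (fun y ↦ fderiv ℝ F y e) :=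
    ((hF.continuous_fderiv (by simp)).clm_apply continuous_const).integrable_of_hasCompactSupport
      (hc.fderiv_apply ℝ e)
  have h := integral_mul_fderiv_eq_neg_fderiv_mul_of_integrable (μ := (volume : Measure (Model m)))
    (f := fun _ ↦ (1 : ℝ)) (g := F) (v := e) (by simp) (by simpa using hint)
    (by simpa using hF.continuous.integrable_of_hasCompactSupport hc)
    (fun x _ ↦ differentiableAt_const _) (fun x _ ↦ hF.differentiable (by simp) x)
  simpa using h

theorem contDiffAt_density {G : Model m → Model m →L[ℝ] Model m →L[ℝ] ℝ} {y : Model m}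
    (h : IsInner (G y)) (hG : ContDiffAt ℝ ∞ G y) : ContDiffAt ℝ ∞ (density G) y := by
  have hdet : ContDiff ℝ ∞ (fun A : Fin m → Fin m → ℝ ↦ (Matrix.of A).det) := by
    simp only [Matrix.det_apply, Matrix.of_apply]
    fun_prop
  have hA : ContDiffAt ℝ ∞ (fun z i j ↦ gram (G z) i j) y := by
    refine contDiffAt_pi.2 fun i ↦ contDiffAt_pi.2 fun j ↦ ?_
    simp only [gram_apply]
    fun_prop
  exact (hdet.contDiffAt.comp y hA).sqrt h.posDef_gram.det_pos.ne'

theorem continuousAt_coordDiv {G : Model m → Model m →L[ℝ] Model m →L[ℝ] ℝ}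
    {t : Model m → Model m} {y : Model m} (h : ∀ᶠ z in 𝓝 y, IsInner (G z))
    (hG : ∀ᶠ z in 𝓝 y, ContDiffAt ℝ ∞ G z) (ht : ∀ᶠ z in 𝓝 y, ContDiffAt ℝ ∞ t z) :
    ContinuousAt (coordDiv G t) y := by
  -- in this form no continuity of inverse matrices is needed
  have heq : coordDiv G t =ᶠ[𝓝 y] fun z ↦
      (∑ j, fderiv ℝ (fun z ↦ 1 * (density G z * t z j)) z (EuclideanSpace.single j 1)) /
        density G z := by
    filter_upwards [h, hG, ht] with z h1 h2 h3
    rw [sum_fderiv_density_mul h1 (h2.differentiableAt (by simp)) (h3.differentiableAt (by simp))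
      (differentiableAt_const _)]
    have := h1.density_pos.ne'
    simp [this]
  refine ContinuousAt.congr ?_ heq.symm
  have hd := contDiffAt_density h.self_of_nhds hG.self_of_nhds
  refine ContinuousAt.div ?_ hd.continuousAt h.self_of_nhds.density_pos.ne'
  refine tendsto_finsetSum _ fun j _ ↦ ?_
  have h1 : ContDiffAt ℝ ∞ (fun z ↦ 1 * (density G z * t z j)) y := by
    have := ht.self_of_nhds
    fun_prop
  exact (h1.continuousAt_fderiv (by simp)).clm_apply continuousAt_const

end Integration

/-! ### The divergence theorem on a compact manifold -/

section DivergenceTheorem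

variable {m : ℕ} {M : Type*} [TopologicalSpace M] [ChartedSpace (Model m) M]

/-- The condition that `g` is a smooth Riemannian metric, in terms of its components in the
charts. -/
structure IsSmoothRiemannian (g : BilinField m M) : Prop where
  inner : ∀ (q : M), ∀ y ∈ (extChartAt (𝓡 m) q).target, IsInner (coordMetric g q y)
  smooth : ∀ (q : M), ∀ y ∈ (extChartAt (𝓡 m) q).target, ContDiffAt ℝ ∞ (coordMetric g q) y

/-- The divergence of the vector field `T`, computed at `p` in the preferred chart at `p`. For smooth
`g` and `T` every other chart gives the same value, see `coordDiv_chart`. -/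
def divergence (g : BilinField m M) (T : VField m M) (p : M) : ℝ :=
  coordDiv (coordMetric g p) (coordField T p) (extChartAt (𝓡 m) p p)

/-- The integral, with respect to the Riemannian volume, of a function supported in the domain of
the preferred chart at `q`. -/
def chartIntegral (g : BilinField m M) (q : M) (f : M → ℝ) : ℝ :=
  ∫ y in (extChartAt (𝓡 m) q).target,
    f ((extChartAt (𝓡 m) q).symm y) * density (coordMetric g q) y

variable [IsManifold (𝓡 m) ∞ M]

/-- The divergence can be computed in every chart. -/
theorem coordDiv_chart {g : BilinField m M} (hg : IsSmoothRiemannian g) {T : VField m M}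
    (hT : ∀ (q : M), ∀ y ∈ (extChartAt (𝓡 m) q).target, ContDiffAt ℝ ∞ (coordField T q) y)
    (q : M) {y : Model m} (hy : y ∈ (extChartAt (𝓡 m) q).target) :
    coordDiv (coordMetric g q) (coordField T q) y =
      divergence g T ((extChartAt (𝓡 m) q).symm y) := by
  set l := (extChartAt (𝓡 m) q).symm y with hl
  have hyo : y ∈ overlap q l := ⟨hy, mem_extChartAt_source l⟩
  have hto := transition_mem_overlap hyo
  have hev := (isOpen_overlap q l).mem_nhds hyo
  have h := coordDiv_pullback (G := coordMetric g q) (B := coordMetric g l)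
    (h := transition q l) (t := coordField T q) (s := coordField T l) (y := y)
    (by filter_upwards [hev] with z hz using coordMetric_transition g hz)
    (by filter_upwards [hev] with z hz using coordField_transition T hz)
    ((hg.smooth q y hy).differentiableAt (by simp))
    ((hg.smooth l _ hto.1).differentiableAt (by simp))
    (contDiffAt_transition hyo)
    ((hT q y hy).differentiableAt (by simp)) ((hT l _ hto.1).differentiableAt (by simp))
    (det_fderiv_transition_ne_zero hyo)
  exact h

/-- The integral of a function supported in two charts is the same in both, by the change of
variables formula on their overlap. -/
theorem chartIntegral_eq {g : BilinField m M} {q l : M} {f : M → ℝ}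
    (hq : Function.support f ⊆ (extChartAt (𝓡 m) q).source)
    (hl : Function.support f ⊆ (extChartAt (𝓡 m) l).source) :
    chartIntegral g q f = chartIntegral g l f := by
  have key : ∀ q l : M, Function.support f ⊆ (extChartAt (𝓡 m) l).source →
      chartIntegral g q f = ∫ y in (overlap q l : Set (Model m)),
        f ((extChartAt (𝓡 m) q).symm y) * density (coordMetric g q) y := by
    intro q l hl
    rw [chartIntegral]
    refine setIntegral_eq_of_subset_of_forall_sdiff_eq_zero (μ := volume)
      (isOpen_extChartAt_target (I := 𝓡 m) q).measurableSet Set.inter_subset_left ?_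
    rintro y ⟨hy, hy'⟩
    have : f ((extChartAt (𝓡 m) q).symm y) = 0 := by
      by_contra h
      exact hy' ⟨hy, hl h⟩
    rw [this, zero_mul]
  rw [key q l hl, key l q hq, ← transition_image_overlap q l,
    integral_image_eq_integral_abs_det_fderiv_smul volume (isOpen_overlap q l).measurableSet
    (fun y hy ↦ ((contDiffAt_transition hy).differentiableAt
      (by simp)).hasFDerivAt.hasFDerivWithinAt) (injOn_transition q l)]
  refine setIntegral_congr_fun (isOpen_overlap q l).measurableSet fun y hy ↦ ?_
  simp only [symm_transition hy, smul_eq_mul,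
    density_pullback (coordMetric_transition g hy)]
  ring

/-- The derivative of a function along a vector field, in a chart. -/
theorem mvfderiv_chart {f : M → ℝ} (hf : ContMDiff (𝓡 m) 𝓘(ℝ, ℝ) ∞ f) (T : VField m M) (q : M)
    {y : Model m} (hy : y ∈ (extChartAt (𝓡 m) q).target) :
    mvfderiv (𝓡 m) f ((extChartAt (𝓡 m) q).symm y) (T ((extChartAt (𝓡 m) q).symm y)) =
      fderiv ℝ (fun z ↦ f ((extChartAt (𝓡 m) q).symm z)) y (coordField T q y) := by
  have h := mfderiv_comp y ((hf ((extChartAt (𝓡 m) q).symm y)).mdifferentiableAt (by simp))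
    ((contMDiffAt_extChartAt_symm q hy).mdifferentiableAt (by simp))
  have h2 := congrArg (fun L : Model m →L[ℝ] ℝ ↦ L (coordField T q y)) h
  rw [mfderiv_eq_fderiv] at h2
  refine Eq.trans ?_ h2.symm
  change _ = (mfderiv (𝓡 m) 𝓘(ℝ, ℝ) f ((extChartAt (𝓡 m) q).symm y) : Model m →L[ℝ] ℝ)
    (frame q y (coordField T q y))
  rw [frame_coordField T q hy]
  rfl

theorem contDiffAt_comp_symm {f : M → ℝ} (hf : ContMDiff (𝓡 m) 𝓘(ℝ, ℝ) ∞ f) (q : M)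
    {y : Model m} (hy : y ∈ (extChartAt (𝓡 m) q).target) :
    ContDiffAt ℝ ∞ (fun z ↦ f ((extChartAt (𝓡 m) q).symm z)) y :=
  ((hf _).comp y (contMDiffAt_extChartAt_symm q hy)).contDiffAt

omit [IsManifold (𝓡 m) ∞ M] in
theorem continuous_of_chart {F : M → ℝ}
    (h : ∀ p : M, ContinuousAt (fun z ↦ F ((extChartAt (𝓡 m) p).symm z)) (extChartAt (𝓡 m) p p)) :
    Continuous F := by
  refine continuous_iff_continuousAt.2 fun p ↦ ?_
  have h1 := ContinuousAt.comp (f := extChartAt (𝓡 m) p) (h p) (continuousAt_extChartAt p)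
  refine h1.congr ?_
  filter_upwards [(isOpen_extChartAt_source (I := 𝓡 m) p).mem_nhds (mem_extChartAt_source p)]
    with x hx
  simp only [Function.comp_apply, (extChartAt (𝓡 m) p).left_inv hx]

theorem continuous_divergence {g : BilinField m M} (hg : IsSmoothRiemannian g) {T : VField m M}
    (hT : ∀ (q : M), ∀ y ∈ (extChartAt (𝓡 m) q).target, ContDiffAt ℝ ∞ (coordField T q) y) :
    Continuous (divergence g T) := by
  refine continuous_of_chart (m := m) fun p ↦ ?_
  have hev := (isOpen_extChartAt_target (I := 𝓡 m) p).mem_nhds (mem_extChartAt_target p)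
  have h := continuousAt_coordDiv (G := coordMetric g p) (t := coordField T p)
    (by filter_upwards [hev] with z hz using hg.inner p z hz)
    (by filter_upwards [hev] with z hz using hg.smooth p z hz)
    (by filter_upwards [hev] with z hz using hT p z hz)
  refine h.congr ?_
  filter_upwards [hev] with z hz using coordDiv_chart hg hT p hz

theorem continuous_mvfderiv {f : M → ℝ} (hf : ContMDiff (𝓡 m) 𝓘(ℝ, ℝ) ∞ f) {T : VField m M}
    (hT : ∀ (q : M), ∀ y ∈ (extChartAt (𝓡 m) q).target, ContDiffAt ℝ ∞ (coordField T q) y) :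
    Continuous (fun p ↦ mvfderiv (𝓡 m) f p (T p)) := by
  refine continuous_of_chart (m := m) fun p ↦ ?_
  have hp := mem_extChartAt_target (I := 𝓡 m) p
  have hev := (isOpen_extChartAt_target (I := 𝓡 m) p).mem_nhds hp
  have h : ContinuousAt (fun y ↦ fderiv ℝ (fun z ↦ f ((extChartAt (𝓡 m) p).symm z)) y
      (coordField T p y)) (extChartAt (𝓡 m) p p) :=
    ((contDiffAt_comp_symm hf p hp).continuousAt_fderiv (by simp)).clm_apply
      (hT p _ hp).continuousAt
  refine h.congr ?_
  filter_upwards [hev] with z hz using (mvfderiv_chart hf T p hz).symm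

omit [IsManifold (𝓡 m) ∞ M] in
/-- A function `F` on the target of a chart that vanishes off the image of a closed set `S` contained
in the domain of the chart, extended by zero to `ℝᵐ`: the extension has compact support, because
`M` is compact, and locally it agrees with `F` on the target or with `0`. So it is as regular as `F`
is on the target. -/
theorem eventuallyEq_indicator_or_zero [CompactSpace M] {F : Model m → ℝ} {S : Set M}
    (hS : IsClosed S) (q : M) (hSq : S ⊆ (extChartAt (𝓡 m) q).source)
    (hF : ∀ y ∈ (extChartAt (𝓡 m) q).target, (extChartAt (𝓡 m) q).symm y ∉ S → F y = 0) :
    HasCompactSupport ((extChartAt (𝓡 m) q).target.indicator F) ∧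
    ∀ y, (y ∈ (extChartAt (𝓡 m) q).target ∧
        (extChartAt (𝓡 m) q).target.indicator F =ᶠ[𝓝 y] F) ∨
      (extChartAt (𝓡 m) q).target.indicator F =ᶠ[𝓝 y] fun _ ↦ 0 := by
  have hK : IsCompact (extChartAt (𝓡 m) q '' S) :=
    hS.isCompact.image_of_continuousOn ((continuousOn_extChartAt q).mono hSq)
  have hz : ∀ y ∉ extChartAt (𝓡 m) q '' S, (extChartAt (𝓡 m) q).target.indicator F y = 0 := by
    intro y hy
    by_cases hyt : y ∈ (extChartAt (𝓡 m) q).target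
    · rw [Set.indicator_of_mem hyt]
      exact hF y hyt fun h ↦ hy ⟨_, h, (extChartAt (𝓡 m) q).right_inv hyt⟩
    · exact Set.indicator_of_notMem hyt F
  refine ⟨HasCompactSupport.intro hK hz, fun y ↦ ?_⟩
  by_cases hy : y ∈ (extChartAt (𝓡 m) q).target
  · left
    refine ⟨hy, ?_⟩
    filter_upwards [(isOpen_extChartAt_target q).mem_nhds hy] with z hz
    exact Set.indicator_of_mem hz F
  · right
    have hyK : y ∉ extChartAt (𝓡 m) q '' S := by
      rintro ⟨x, hx, rfl⟩
      exact hy ((extChartAt (𝓡 m) q).map_source (hSq hx))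
    filter_upwards [hK.isClosed.isOpen_compl.mem_nhds hyK] with z hzK using hz z hzK

theorem integrableOn_chart [CompactSpace M] {g : BilinField m M} (hg : IsSmoothRiemannian g)
    {f : M → ℝ} (hf : Continuous f) (q : M) (hfq : tsupport f ⊆ (extChartAt (𝓡 m) q).source) :
    IntegrableOn (fun y ↦ f ((extChartAt (𝓡 m) q).symm y) * density (coordMetric g q) y)
      (extChartAt (𝓡 m) q).target := by
  obtain ⟨h1, h2⟩ := eventuallyEq_indicator_or_zero
    (F := fun y ↦ f ((extChartAt (𝓡 m) q).symm y) * density (coordMetric g q) y)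
    (isClosed_tsupport f) q hfq (fun y _ h ↦ by
      rw [image_eq_zero_of_notMem_tsupport h, zero_mul])
  rw [← integrable_indicator_iff (isOpen_extChartAt_target q).measurableSet]
  refine Continuous.integrable_of_hasCompactSupport ?_ h1
  refine continuous_iff_continuousAt.2 fun y ↦ ?_
  rcases h2 y with ⟨hy, h⟩ | h
  · refine ContinuousAt.congr ?_ h.symm
    exact (hf.continuousAt.comp (contMDiffAt_extChartAt_symm q hy).continuousAt).mul
      (contDiffAt_density (hg.inner q y hy) (hg.smooth q y hy)).continuousAt
  · exact continuousAt_const.congr h.symm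

/-- Integration by parts against a function `f` supported in one chart:
`∫ (f div T + T f) = ∫ div(f T) = 0`. -/
theorem chartIntegral_divergence [CompactSpace M] {g : BilinField m M} (hg : IsSmoothRiemannian g)
    {T : VField m M}
    (hT : ∀ (q : M), ∀ y ∈ (extChartAt (𝓡 m) q).target, ContDiffAt ℝ ∞ (coordField T q) y)
    {f : M → ℝ} (hf : ContMDiff (𝓡 m) 𝓘(ℝ, ℝ) ∞ f) (q : M)
    (hfq : tsupport f ⊆ (extChartAt (𝓡 m) q).source) :
    chartIntegral g q (fun p ↦ f p * divergence g T p + mvfderiv (𝓡 m) f p (T p)) = 0 := by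
  let F : Fin m → Model m → ℝ := fun j y ↦
    f ((extChartAt (𝓡 m) q).symm y) * (density (coordMetric g q) y * coordField T q y j)
  let Fc : Fin m → Model m → ℝ := fun j ↦ (extChartAt (𝓡 m) q).target.indicator (F j)
  have hF := fun j ↦ eventuallyEq_indicator_or_zero (F := F j) (isClosed_tsupport f) q hfq
    (fun y _ h ↦ by simp only [F]; rw [image_eq_zero_of_notMem_tsupport h, zero_mul])
  have hFsmooth : ∀ j, ContDiff ℝ 1 (Fc j) := fun j ↦ by
    refine contDiff_iff_contDiffAt.2 fun y ↦ ?_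
    rcases (hF j).2 y with ⟨hy, h⟩ | h
    · refine ContDiffAt.congr_of_eventuallyEq ?_ h
      have h1 := contDiffAt_comp_symm hf q hy
      have h2 := contDiffAt_density (hg.inner q y hy) (hg.smooth q y hy)
      have h3 := hT q y hy
      have h4 : ContDiffAt ℝ ∞ (fun z ↦ coordField T q z j) y :=
        (EuclideanSpace.proj j : Model m →L[ℝ] ℝ).contDiff.contDiffAt.comp y h3
      exact (h1.mul (h2.mul h4)).of_le (by simp)
    · exact contDiffAt_const.congr_of_eventuallyEq h
  have hint : ∀ j, Integrable (fun y ↦ fderiv ℝ (Fc j) y (EuclideanSpace.single j 1)) := fun j ↦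
    (((hFsmooth j).continuous_fderiv (by simp)).clm_apply
      continuous_const).integrable_of_hasCompactSupport ((hF j).1.fderiv_apply ℝ _)
  have hsum : ∫ y, ∑ j, fderiv ℝ (Fc j) y (EuclideanSpace.single j 1) = 0 := by
    rw [integral_finsetSum _ fun j _ ↦ hint j]
    exact Finset.sum_eq_zero fun j _ ↦ integral_fderiv_apply_eq_zero (hFsmooth j) (hF j).1 _
  rw [chartIntegral, ← integral_indicator (isOpen_extChartAt_target q).measurableSet, ← hsum]
  congr 1
  funext y
  by_cases hy : y ∈ (extChartAt (𝓡 m) q).target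
  · have hev := (isOpen_extChartAt_target q).mem_nhds hy
    have h1 : ∀ j, fderiv ℝ (Fc j) y = fderiv ℝ (F j) y := fun j ↦ by
      refine Filter.EventuallyEq.fderiv_eq ?_
      filter_upwards [hev] with z hz using Set.indicator_of_mem hz _
    simp only [h1]
    rw [Set.indicator_of_mem hy, sum_fderiv_density_mul (hg.inner q y hy)
      ((hg.smooth q y hy).differentiableAt (by simp)) ((hT q y hy).differentiableAt (by simp))
      ((contDiffAt_comp_symm hf q hy).differentiableAt (by simp)), coordDiv_chart hg hT q hy,
      mvfderiv_chart hf T q hy]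
  · rw [Set.indicator_of_notMem hy]
    refine (Finset.sum_eq_zero fun j _ ↦ ?_).symm
    rcases (hF j).2 y with ⟨hy', _⟩ | h
    · exact absurd hy' hy
    · change fderiv ℝ (Fc j) y _ = 0
      rw [Filter.EventuallyEq.fderiv_eq h]
      simp

omit [IsManifold (𝓡 m) ∞ M] in
theorem mvfderiv_eq_zero_of_notMem_tsupport {f : M → ℝ} {p : M} (hp : p ∉ tsupport f) :
    mvfderiv (𝓡 m) f p = 0 := by
  have h : f =ᶠ[𝓝 p] fun _ ↦ (0 : ℝ) := notMem_tsupport_iff_eventuallyEq.1 hp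
  have h1 : mfderiv (𝓡 m) 𝓘(ℝ, ℝ) f p = 0 := by
    rw [h.mfderiv_eq]
    exact mfderiv_const
  ext v
  simp [mvfderiv, h1]

/-- On a compact Riemannian manifold a vector field whose divergence is nonpositive is divergence
free. With a partition of unity `ρ`, `∑ᵢ ∫ ρᵢ div T = -∑ᵢ ∫ T ρᵢ`, and the right-hand side
vanishes because `∑ᵢ ρᵢ = 1`; as every term on the left is nonpositive, all of them vanish. -/
theorem divergence_eq_zero [T2Space M] [CompactSpace M] {g : BilinField m M}
    (hg : IsSmoothRiemannian g) {T : VField m M}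
    (hT : ∀ (q : M), ∀ y ∈ (extChartAt (𝓡 m) q).target, ContDiffAt ℝ ∞ (coordField T q) y)
    (hle : ∀ p, divergence g T p ≤ 0) (p : M) : divergence g T p = 0 := by
  classical
  obtain ⟨s, hs⟩ := (isCompact_univ (X := M)).elim_finite_subcover
    (fun q : M ↦ (extChartAt (𝓡 m) q).source) (fun q ↦ isOpen_extChartAt_source q)
    (fun x _ ↦ Set.mem_iUnion.2 ⟨x, mem_extChartAt_source x⟩)
  obtain ⟨ρ, hρ⟩ := SmoothPartitionOfUnity.exists_isSubordinate (𝓡 m) (isClosed_univ (X := M))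
    (fun q : s ↦ (extChartAt (𝓡 m) (q : M)).source) (fun q ↦ isOpen_extChartAt_source _)
    (fun x hx ↦ by simpa using hs hx)
  have hsum1 : ∀ x, ∑ i, ρ i x = 1 := fun x ↦ by
    rw [← finsum_eq_sum_of_fintype]
    exact ρ.sum_eq_one (Set.mem_univ x)
  have hρs : ∀ i, ContMDiff (𝓡 m) 𝓘(ℝ, ℝ) ∞ (ρ i) := fun i ↦ (ρ i).contMDiff
  let D : s → M → ℝ := fun i x ↦ mvfderiv (𝓡 m) (ρ i) x (T x)
  have hD : ∀ i, Continuous (D i) := fun i ↦ continuous_mvfderiv (hρs i) hT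
  have hDsupp : ∀ i, Function.support (D i) ⊆ tsupport (ρ i) := fun i x hx ↦ by
    by_contra h
    exact hx (by simp only [D, mvfderiv_eq_zero_of_notMem_tsupport h]; rfl)
  have hDts : ∀ i, tsupport (D i) ⊆ tsupport (ρ i) := fun i ↦
    closure_minimal (hDsupp i) (isClosed_tsupport _)
  have hDsum : ∀ x, ∑ i, D i x = 0 := fun x ↦ by
    have hx := mem_extChartAt_target (I := 𝓡 m) x
    have h1 : ∀ i, D i x = fderiv ℝ (fun z ↦ ρ i ((extChartAt (𝓡 m) x).symm z))
        (extChartAt (𝓡 m) x x) (coordField T x (extChartAt (𝓡 m) x x)) := fun i ↦ by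
      have h2 := mvfderiv_chart (hρs i) T x hx
      rwa [extChartAt_to_inv] at h2
    simp only [h1]
    rw [← sum_apply, ← fderiv_fun_sum fun i _ ↦
      (contDiffAt_comp_symm (hρs i) x hx).differentiableAt (by simp)]
    simp only [hsum1, fderiv_fun_const]
    rfl
  have hdiv := continuous_divergence hg hT
  have hρD : ∀ l i, tsupport (fun x ↦ ρ l x * D i x) ⊆ tsupport (ρ l) ∩ tsupport (D i) :=
    fun l i ↦ Set.subset_inter (tsupport_mul_subset_left) (tsupport_mul_subset_right)
  have hint : ∀ l i j : s, (j = l ∨ j = i) → IntegrableOn (fun y ↦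
      (ρ l ((extChartAt (𝓡 m) (j : M)).symm y) * D i ((extChartAt (𝓡 m) (j : M)).symm y)) *
        density (coordMetric g (j : M)) y)
      (extChartAt (𝓡 m) (j : M)).target := by
    intro l i j hj
    refine integrableOn_chart hg (f := fun x ↦ ρ l x * D i x) ((hρs l).continuous.mul (hD i)) j ?_
    rcases hj with rfl | rfl
    · exact (hρD _ _).trans (Set.inter_subset_left.trans (hρ _))
    · exact (hρD _ _).trans (Set.inter_subset_right.trans ((hDts _).trans (hρ _)))
  -- `T ρᵢ` is supported in the chart of `ρᵢ`; splitting it as `∑ₗ ρₗ T ρᵢ` and moving each term to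
  -- the chart of `ρₗ` allows to sum over `i` first
  have hzero : ∑ i : s, chartIntegral g (i : M) (D i) = 0 := by
    have h1 : ∀ i : s, chartIntegral g (i : M) (D i) =
        ∑ l : s, chartIntegral g (l : M) (fun x ↦ ρ l x * D i x) := by
      intro i
      have h2 : chartIntegral g (i : M) (D i) =
          ∑ l : s, chartIntegral g (i : M) (fun x ↦ ρ l x * D i x) := by
        simp only [chartIntegral]
        rw [← integral_finsetSum _ fun l _ ↦ hint l i i (Or.inr rfl)]
        congr 1
        funext y
        rw [← Finset.sum_mul, ← Finset.sum_mul, hsum1, one_mul]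
      rw [h2]
      refine Finset.sum_congr rfl fun l _ ↦ chartIntegral_eq ?_ ?_
      · exact (subset_tsupport _).trans ((hρD _ _).trans
          (Set.inter_subset_right.trans ((hDts _).trans (hρ _))))
      · exact (subset_tsupport _).trans ((hρD _ _).trans (Set.inter_subset_left.trans (hρ _)))
    simp only [h1]
    rw [Finset.sum_comm]
    refine Finset.sum_eq_zero fun l _ ↦ ?_
    simp only [chartIntegral]
    rw [← integral_finsetSum _ fun i _ ↦ hint l i l (Or.inl rfl)]
    simp only [← Finset.sum_mul, ← Finset.mul_sum, hDsum, mul_zero, zero_mul, integral_zero]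
  have hρdts : ∀ i, tsupport (fun x ↦ ρ i x * divergence g T x) ⊆
      (extChartAt (𝓡 m) (i : M)).source := fun i ↦ tsupport_mul_subset_left.trans (hρ i)
  have hρdint := fun i : s ↦ integrableOn_chart hg (f := fun x ↦ ρ i x * divergence g T x)
    ((hρs i).continuous.mul hdiv) i (hρdts i)
  have hsplit : ∀ i : s, chartIntegral g (i : M) (fun x ↦ ρ i x * divergence g T x) =
      - chartIntegral g (i : M) (D i) := by
    intro i
    have h1 := chartIntegral_divergence hg hT (hρs i) i (hρ i)
    have h2 := integrableOn_chart hg (hD i) i ((hDts i).trans (hρ i))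
    rw [eq_neg_iff_add_eq_zero, ← h1]
    simp only [chartIntegral]
    rw [← integral_add (hρdint i) h2]
    congr 1
    funext y
    ring
  have hnonpos : ∀ i : s, ∀ y ∈ (extChartAt (𝓡 m) (i : M)).target,
      ρ i ((extChartAt (𝓡 m) (i : M)).symm y) * divergence g T ((extChartAt (𝓡 m) (i : M)).symm y)
        * density (coordMetric g (i : M)) y ≤ 0 := fun i y _ ↦
    mul_nonpos_of_nonpos_of_nonneg (mul_nonpos_of_nonneg_of_nonpos (ρ.nonneg i _) (hle _))
      (Real.sqrt_nonneg _)
  have hIzero : ∀ i : s, chartIntegral g (i : M) (fun x ↦ ρ i x * divergence g T x) = 0 := by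
    have h1 : ∑ i : s, chartIntegral g (i : M) (fun x ↦ ρ i x * divergence g T x) = 0 := by
      simp only [hsplit, Finset.sum_neg_distrib, hzero, neg_zero]
    intro i
    refine (Finset.sum_eq_zero_iff_of_nonpos fun i _ ↦ ?_).1 h1 i (Finset.mem_univ i)
    exact setIntegral_nonpos (isOpen_extChartAt_target _).measurableSet (hnonpos i)
  have hexists : ∃ i : s, 0 < ρ i p := by
    by_contra! h
    have := Finset.sum_nonpos fun i (_ : i ∈ Finset.univ) ↦ h i
    rw [hsum1 p] at this
    linarith
  obtain ⟨i, hi⟩ := hexists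
  have hpi : p ∈ (extChartAt (𝓡 m) (i : M)).source := hρ i (subset_tsupport _ hi.ne')
  have hto := isOpen_extChartAt_target (I := 𝓡 m) (i : M)
  -- a continuous integrand of constant sign with zero integral vanishes everywhere
  have hae := (setIntegral_eq_zero_iff_of_nonneg_ae (μ := volume)
    (s := (extChartAt (𝓡 m) (i : M)).target) (f := fun y ↦
      -(ρ i ((extChartAt (𝓡 m) (i : M)).symm y) *
        divergence g T ((extChartAt (𝓡 m) (i : M)).symm y) * density (coordMetric g (i : M)) y))
    (by
      filter_upwards [ae_restrict_mem hto.measurableSet] with y hy using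
        neg_nonneg.2 (hnonpos i y hy))
    (hρdint i).neg).1 (by rw [integral_neg]; exact neg_eq_zero.2 (hIzero i))
  have hcont : ContinuousOn (fun y ↦ -(ρ i ((extChartAt (𝓡 m) (i : M)).symm y) *
      divergence g T ((extChartAt (𝓡 m) (i : M)).symm y) * density (coordMetric g (i : M)) y))
      (extChartAt (𝓡 m) (i : M)).target := fun y hy ↦
    ((((hρs i).continuous.mul hdiv).continuousAt.comp
      (contMDiffAt_extChartAt_symm (i : M) hy).continuousAt).mul
      (contDiffAt_density (hg.inner i y hy) (hg.smooth i y hy)).continuousAt).neg.continuousWithinAt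
  have hpt := (extChartAt (𝓡 m) (i : M)).map_source hpi
  have hz := Measure.eqOn_open_of_ae_eq hae hto hcont continuousOn_const hpt
  simp only [(extChartAt (𝓡 m) (i : M)).left_inv hpi, Pi.zero_apply, neg_eq_zero,
    mul_eq_zero] at hz
  rcases hz with (h | h) | h
  · exact absurd h hi.ne'
  · exact h
  · exact absurd h (hg.inner i _ hpt).density_pos.ne'

end DivergenceTheorem

/-! ### The conformal equation at the centre of a chart -/

section Center

variable {m n : ℕ} {M : Type*} [TopologicalSpace M] [ChartedSpace (Model m) M]
  [IsManifold (𝓡 m) ∞ M] {N : Type*} [TopologicalSpace N] [ChartedSpace (Model n) N]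
  [IsManifold (𝓡 n) ∞ N]

/-- The value of a vector field at `p`, as an element of `ℝᵐ`. Every tangent space is the type `ℝᵐ`;
this definition and the following ones fix that reading, so that the values at different points
and their components in charts live in one space. -/
def fieldVal (T : VField m M) (p : M) : Model m := T p

/-- The value of a field of bilinear forms at `p`, as a bilinear form on `ℝᵐ`. -/
def formAt (g : BilinField m M) (p : M) : Model m →L[ℝ] Model m →L[ℝ] ℝ := g p

/-- The differential at `p` of a vector-valued function, as a linear map on `ℝᵐ`. -/
def diffAt {F : Type*} [NormedAddCommGroup F] [NormedSpace ℝ F] (f : M → F) (p : M) :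
    Model m →L[ℝ] F := mvfderiv (𝓡 m) f p

omit [IsManifold (𝓡 m) ∞ M] in
theorem diffAt_eq_fderiv {F : Type*} [NormedAddCommGroup F] [NormedSpace ℝ F] {f : M → F} {p : M}
    (hf : MDifferentiableAt (𝓡 m) 𝓘(ℝ, F) f p) :
    diffAt f p = fderiv ℝ (fun z ↦ f ((extChartAt (𝓡 m) p).symm z)) (extChartAt (𝓡 m) p p) := by
  have h := hf.mvfderiv
  rw [ModelWithCorners.range_eq_univ, fderivWithin_univ] at h
  exact h

theorem coframe_self (p : M) : coframe p p = ContinuousLinearMap.id ℝ (Model m) := by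
  have : IsManifold (𝓡 m) 1 M := IsManifold.of_le (n := ∞) (by simp)
  exact mfderiv_extChartAt_self (I := 𝓡 m)

theorem coordField_center (T : VField m M) (p : M) :
    coordField T p (extChartAt (𝓡 m) p p) = fieldVal T p := by
  refine (coordField_eq_iff T p (mem_extChartAt_target p)).2 ?_
  rw [frame_self]
  exact vField_congr T (extChartAt_to_inv p)

theorem chartField_center (p : M) (u : Model m) : fieldVal (chartField p u) p = u := by
  rw [← coordField_center (chartField p u) p, coordField_chartField p (mem_extChartAt_target p)]

theorem coordMetric_center (g : BilinField m M) (p : M) :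
    coordMetric g p (extChartAt (𝓡 m) p p) = formAt g p := by
  ext u v
  rw [coordMetric_eq_frame, frame_self]
  exact bilinField_congr g (extChartAt_to_inv p) u v

/-- The Lie bracket with a coordinate field is, up to sign, a partial derivative of the
components. -/
theorem mlieBracket_chartField (X : VField m M) (p : M) (u : Model m) :
    fieldVal (VectorField.mlieBracket (𝓡 m) X (chartField p u)) p =
      -fderiv ℝ (coordField X p) (extChartAt (𝓡 m) p p) u := by
  have hp := mem_extChartAt_target (I := 𝓡 m) p
  have h1 : coordField (chartField p u) p =ᶠ[𝓝 (extChartAt (𝓡 m) p p)] fun _ ↦ u := by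
    filter_upwards [(isOpen_extChartAt_target p).mem_nhds hp] with z hz using
      coordField_chartField p hz u
  have h2 : ∀ Y : VField m M, VectorField.mpullbackWithin 𝓘(ℝ, Model m) (𝓡 m)
      (extChartAt (𝓡 m) p).symm Y (Set.range (𝓡 m)) = coordField Y p := fun Y ↦ by
    rw [ModelWithCorners.range_eq_univ, VectorField.mpullbackWithin_univ]
    rfl
  have h3 : fieldVal (VectorField.mlieBracket (𝓡 m) X (chartField p u)) p =
      (coframe p p).inverse (VectorField.lieBracketWithin ℝ (coordField X p)
        (coordField (chartField p u) p)
        ((extChartAt (𝓡 m) p).symm ⁻¹' Set.univ ∩ Set.range (𝓡 m)) (extChartAt (𝓡 m) p p)) := by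
    rw [← h2, ← h2]
    rfl
  rw [h3, coframe_self, ContinuousLinearMap.inverse_id, ModelWithCorners.range_eq_univ,
    Set.preimage_univ, Set.inter_univ, VectorField.lieBracketWithin_univ, VectorField.lieBracket,
    h1.fderiv_eq, h1.self_of_nhds]
  simp

/-- The conformal equation in coordinates, at the centre of a chart. -/
theorem IsConformalField.lieTensor_center {g : BilinField m M} {X : VField m M} {η : M → ℝ}
    (hconf : IsConformalField g X η)
    (hg : ∀ (q : M), ∀ y ∈ (extChartAt (𝓡 m) q).target, ContDiffAt ℝ ∞ (coordMetric g q) y)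
    (p : M) (u v : Model m) :
    lieTensor (coordMetric g p) (coordField X p) (extChartAt (𝓡 m) p p) u v =
      2 * η p * coordMetric g p (extChartAt (𝓡 m) p p) u v := by
  have hp := mem_extChartAt_target (I := 𝓡 m) p
  have hps := mem_extChartAt_source (I := 𝓡 m) p
  have hGd := (hg p _ hp).differentiableAt (by simp)
  have h := hconf p (chartField p u) (chartField p v) (smoothAt_chartField p hps u)
    (smoothAt_chartField p hps v)
  have heq : (fun x ↦ g x (chartField p u x) (chartField p v x)) =ᶠ[𝓝 p]
      fun x ↦ coordMetric g p (extChartAt (𝓡 m) p x) u v := by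
    filter_upwards [(isOpen_extChartAt_source p).mem_nhds hps] with x hx
    have hxt := (extChartAt (𝓡 m) p).map_source hx
    rw [coordMetric_eq_frame, ← chartField_symm p hxt, ← chartField_symm p hxt,
      (extChartAt (𝓡 m) p).left_inv hx]
  have hd : DifferentiableAt ℝ (fun z ↦ coordMetric g p z u v) (extChartAt (𝓡 m) p p) :=
    (hGd.clm_apply (differentiableAt_const u)).clm_apply (differentiableAt_const v)
  have hmd : MDifferentiableAt (𝓡 m) 𝓘(ℝ, ℝ)
      (fun x ↦ coordMetric g p (extChartAt (𝓡 m) p x) u v) p :=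
    hd.mdifferentiableAt.comp p ((contMDiffAt_extChartAt (n := ∞)).mdifferentiableAt (by simp))
  have h1 : diffAt (fun x ↦ g x (chartField p u x) (chartField p v x)) p =
      ((fderiv ℝ (coordMetric g p) (extChartAt (𝓡 m) p p)).flip u).flip v := by
    rw [diffAt_eq_fderiv (hmd.congr_of_eventuallyEq heq)]
    have heq2 : (fun z ↦ g ((extChartAt (𝓡 m) p).symm z)
        (chartField p u ((extChartAt (𝓡 m) p).symm z))
        (chartField p v ((extChartAt (𝓡 m) p).symm z))) =ᶠ[𝓝 (extChartAt (𝓡 m) p p)]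
        fun z ↦ coordMetric g p z u v := by
      filter_upwards [(isOpen_extChartAt_target p).mem_nhds hp] with z hz
      rw [coordMetric_eq_frame, ← chartField_symm p hz, ← chartField_symm p hz]
    rw [heq2.fderiv_eq]
    have h2 := ((hGd.hasFDerivAt.clm_apply (hasFDerivAt_const u _)).clm_apply
      (hasFDerivAt_const v _)).fderiv
    rw [h2]
    ext w
    simp
  have h2 : diffAt (fun x ↦ g x (chartField p u x) (chartField p v x)) p (fieldVal X p)
      - formAt g p (fieldVal (VectorField.mlieBracket (𝓡 m) X (chartField p u)) p)
        (fieldVal (chartField p v) p)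
      - formAt g p (fieldVal (chartField p u) p)
        (fieldVal (VectorField.mlieBracket (𝓡 m) X (chartField p v)) p) =
      2 * η p * formAt g p (fieldVal (chartField p u) p) (fieldVal (chartField p v) p) := h
  rw [h1, mlieBracket_chartField, mlieBracket_chartField, chartField_center,
    chartField_center] at h2
  rw [lieTensor_apply, coordField_center, coordMetric_center, ← h2]
  simp only [ContinuousLinearMap.flip_apply, map_neg, neg_apply]
  ring

/-- The extension of a tangent vector at `p` used in the second fundamental form has constant
components in the chart at `p`. -/
theorem extend_eq_chartField (p : M) (w : TangentSpace (𝓡 m) p) {x : M}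
    (hx : x ∈ (extChartAt (𝓡 m) p).source) :
    FiberBundle.extend (E := (TangentSpace (𝓡 m) : M → Type _)) (Model m) w x =
      chartField p w x := by
  have : IsManifold (𝓡 m) 1 M := IsManifold.of_le (n := ∞) (by simp)
  have hx' : x ∈ (chartAt (Model m) p).source := by simpa using hx
  have hp' : p ∈ (chartAt (Model m) p).source := mem_chart_source _ _
  have h1 := TangentBundle.symmL_trivializationAt (I := 𝓡 m) hx'
  have h2 := TangentBundle.continuousLinearMapAt_trivializationAt (I := 𝓡 m) hp'
  rw [ModelWithCorners.range_eq_univ, mfderivWithin_univ] at h1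
  rw [mfderiv_extChartAt_self] at h2
  have h3 : ((trivializationAt (Model m) (TangentSpace (𝓡 m)) p) ⟨p, w⟩).2 = w := by
    have h4 := congrArg (fun L : Model m →L[ℝ] Model m ↦ L w) h2
    refine Eq.trans ?_ h4
    symm
    exact congrFun (Bundle.Trivialization.coe_linearMapAt_of_mem
      (trivializationAt (Model m) (TangentSpace (𝓡 m)) p) (R := ℝ)
      (FiberBundle.mem_baseSet_trivializationAt' p)) w
  have h5 := congrArg (fun L : Model m →L[ℝ] Model m ↦ L w) h1
  have h6 := chartField_symm p ((extChartAt (𝓡 m) p).map_source hx) w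
  rw [(extChartAt (𝓡 m) p).left_inv hx] at h6
  refine Eq.trans ?_ (h5.trans h6.symm)
  rw [FiberBundle.extend, h3]
  exact (Bundle.Trivialization.symmL_apply (R := ℝ)
    (trivializationAt (Model m) (TangentSpace (𝓡 m)) p) (by simpa using hx') w).symm

end Center

/-! ### Coordinate expressions along an immersion -/

section Immersion

variable {m n : ℕ} {M : Type*} [TopologicalSpace M] [ChartedSpace (Model m) M]
  [IsManifold (𝓡 m) ∞ M] {N : Type*} [TopologicalSpace N] [ChartedSpace (Model n) N]
  [IsManifold (𝓡 n) ∞ N]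

/-- The coordinate expression of `ψ` in the preferred charts at `q` and `Q`. -/
def localRep (m n : ℕ) {M : Type*} [TopologicalSpace M] [ChartedSpace (Model m) M] {N : Type*}
    [TopologicalSpace N] [ChartedSpace (Model n) N] (ψ : M → N) (q : M) (Q : N) (y : Model m) :
    Model n :=
  extChartAt (𝓡 n) Q (ψ ((extChartAt (𝓡 m) q).symm y))

variable {ψ : M → N}

omit [IsManifold (𝓡 n) ∞ N] in
theorem eventually_mem_source (hψ : ContMDiff (𝓡 m) (𝓡 n) ∞ ψ) {q : M} {Q : N} {y : Model m}
    (hy : y ∈ (extChartAt (𝓡 m) q).target)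
    (hQ : ψ ((extChartAt (𝓡 m) q).symm y) ∈ (extChartAt (𝓡 n) Q).source) :
    ∀ᶠ z in 𝓝 y, z ∈ (extChartAt (𝓡 m) q).target ∧
      ψ ((extChartAt (𝓡 m) q).symm z) ∈ (extChartAt (𝓡 n) Q).source :=
  Filter.Eventually.and ((isOpen_extChartAt_target q).mem_nhds hy)
    ((hψ.continuous.continuousAt.comp
      (contMDiffAt_extChartAt_symm q hy).continuousAt).preimage_mem_nhds ((isOpen_extChartAt_source Q).mem_nhds hQ))

omit [IsManifold (𝓡 n) ∞ N] in
theorem contMDiffAt_comp_symm {q : M} {y : Model m} (hψ : ContMDiff (𝓡 m) (𝓡 n) ∞ ψ)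
    (hy : y ∈ (extChartAt (𝓡 m) q).target) :
    ContMDiffAt 𝓘(ℝ, Model m) (𝓡 n) ∞ (fun z ↦ ψ ((extChartAt (𝓡 m) q).symm z)) y :=
  (hψ _).comp y (contMDiffAt_extChartAt_symm q hy)

theorem contDiffAt_localRep {q : M} {Q : N} {y : Model m} (hψ : ContMDiff (𝓡 m) (𝓡 n) ∞ ψ)
    (hy : y ∈ (extChartAt (𝓡 m) q).target)
    (hQ : ψ ((extChartAt (𝓡 m) q).symm y) ∈ (extChartAt (𝓡 n) Q).source) :
    ContDiffAt ℝ ∞ (localRep m n ψ q Q) y :=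
  ((contMDiffAt_extChartAt' (by simpa using hQ)).comp y (contMDiffAt_comp_symm hψ hy)).contDiffAt

omit [IsManifold (𝓡 n) ∞ N] in
/-- The chain rule for `ψ` after the inverse of a chart. -/
theorem mfderiv_comp_symm {q : M} {y : Model m} (hψ : ContMDiff (𝓡 m) (𝓡 n) ∞ ψ)
    (hy : y ∈ (extChartAt (𝓡 m) q).target) (v : Model m) :
    (mfderiv 𝓘(ℝ, Model m) (𝓡 n) (fun z ↦ ψ ((extChartAt (𝓡 m) q).symm z)) y :
      Model m →L[ℝ] Model n) v =
    (diff m n ψ ((extChartAt (𝓡 m) q).symm y) : Model m →L[ℝ] Model n) (frame q y v) := by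
  have h := mfderiv_comp y ((hψ ((extChartAt (𝓡 m) q).symm y)).mdifferentiableAt (by simp))
    ((contMDiffAt_extChartAt_symm q hy).mdifferentiableAt (by simp))
  exact congrArg (fun L : Model m →L[ℝ] Model n ↦ L v) h

/-- The components of the induced metric, in terms of those of the ambient metric. -/
theorem coordMetric_inducedMetric (g : BilinField n N) {q : M} {Q : N} {y : Model m}
    (hψ : ContMDiff (𝓡 m) (𝓡 n) ∞ ψ)
    (hy : y ∈ (extChartAt (𝓡 m) q).target)
    (hQ : ψ ((extChartAt (𝓡 m) q).symm y) ∈ (extChartAt (𝓡 n) Q).source) (u v : Model m) :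
    coordMetric (inducedMetric g ψ) q y u v = coordMetric g Q (localRep m n ψ q Q y)
      (fderiv ℝ (localRep m n ψ q Q) y u) (fderiv ℝ (localRep m n ψ q Q) y v) := by
  have h := pullback_eq_coordMetric g Q (contMDiffAt_comp_symm hψ hy) hQ u v
  rw [mfderiv_comp_symm hψ hy, mfderiv_comp_symm hψ hy] at h
  exact h

/-- The defining equation of the tangential part `T` of `X` along `ψ`, in coordinates. -/
theorem coordMetric_tangentialPart {g : BilinField n N} {X : VField n N} {T : VField m M}
    (hT : ∀ p v, inducedMetric g ψ p (T p) v = g (ψ p) (X (ψ p)) (diff m n ψ p v))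
    {q : M} {Q : N} {y : Model m} (hψ : ContMDiff (𝓡 m) (𝓡 n) ∞ ψ)
    (hy : y ∈ (extChartAt (𝓡 m) q).target)
    (hQ : ψ ((extChartAt (𝓡 m) q).symm y) ∈ (extChartAt (𝓡 n) Q).source) (v : Model m) :
    coordMetric (inducedMetric g ψ) q y (coordField T q y) v =
      coordMetric g Q (localRep m n ψ q Q y) (coordField X Q (localRep m n ψ q Q y))
        (fderiv ℝ (localRep m n ψ q Q) y v) := by
  have h := pullback_form_eq_coordMetric g X Q (contMDiffAt_comp_symm hψ hy) hQ v
  rw [mfderiv_comp_symm hψ hy] at h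
  refine Eq.trans ?_ ((hT _ (frame q y v)).trans h)
  rw [coordMetric_eq_frame, frame_coordField T q hy]

theorem isSmoothRiemannian_inducedMetric {g : BilinField n N}
    (hg : ∀ (q : N), ∀ y ∈ (extChartAt (𝓡 n) q).target, ContDiffAt ℝ ∞ (coordMetric g q) y)
    (hsymm : ∀ (x : N) (v w : TangentSpace (𝓡 n) x), g x v w = g x w v)
    (hψ : IsSpacelikeImmersion m g ψ) : IsSmoothRiemannian (inducedMetric (m := m) g ψ) where
  inner q y hy := by
    refine ⟨fun u v ↦ ?_, fun u hu ↦ ?_⟩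
    · rw [coordMetric_eq_frame, coordMetric_eq_frame]
      exact hsymm _ _ _
    rw [coordMetric_eq_frame]
    refine hψ.spacelike ((extChartAt (𝓡 m) q).symm y) (frame q y u) ?_
    intro h
    obtain ⟨e, he⟩ := isInvertible_frame q hy
    have h' : frame q y u = 0 := h
    rw [← he] at h'
    exact hu (by simpa using h')
  smooth q y hy := by
    suffices h : ContDiffOn ℝ ∞ (coordMetric (inducedMetric (m := m) g ψ) q)
        (extChartAt (𝓡 m) q).target from
      h.contDiffAt ((isOpen_extChartAt_target q).mem_nhds hy)
    refine contDiffOn_clm_apply.2 fun u ↦ contDiffOn_clm_apply.2 fun v y hy ↦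
      ContDiffAt.contDiffWithinAt ?_
    set Q := ψ ((extChartAt (𝓡 m) q).symm y) with hQdef
    have hQ : ψ ((extChartAt (𝓡 m) q).symm y) ∈ (extChartAt (𝓡 n) Q).source :=
      mem_extChartAt_source _
    have hh := contDiffAt_localRep hψ.smooth hy hQ
    have hB : ContDiffAt ℝ ∞ (fun z ↦ coordMetric g Q (localRep m n ψ q Q z)) y :=
      (hg Q (localRep m n ψ q Q y) ((extChartAt (𝓡 n) Q).map_source hQ)).comp y hh
    have hD : ContDiffAt ℝ ∞ (fderiv ℝ (localRep m n ψ q Q)) y := hh.fderiv_right (by simp)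
    have hd : ContDiffAt ℝ ∞ (fun z ↦ coordMetric g Q (localRep m n ψ q Q z)
        (fderiv ℝ (localRep m n ψ q Q) z u) (fderiv ℝ (localRep m n ψ q Q) z v)) y :=
      (hB.clm_apply (hD.clm_apply contDiffAt_const)).clm_apply (hD.clm_apply contDiffAt_const)
    refine hd.congr_of_eventuallyEq ?_
    filter_upwards [eventually_mem_source hψ.smooth hy hQ] with z hz using
      coordMetric_inducedMetric g hψ.smooth hz.1 hz.2 u v

/-- The tangential part of a smooth vector field is smooth, being obtained from it by inverting the
induced metric. -/
theorem contDiffAt_tangentialPart {g : BilinField n N}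
    (hg : ∀ (q : N), ∀ y ∈ (extChartAt (𝓡 n) q).target, ContDiffAt ℝ ∞ (coordMetric g q) y)
    (hψ : ContMDiff (𝓡 m) (𝓡 n) ∞ ψ) (hG : IsSmoothRiemannian (inducedMetric (m := m) g ψ))
    {X : VField n N} (hX : ∀ x, X.SmoothAt x) {T : VField m M}
    (hT : ∀ p v, inducedMetric g ψ p (T p) v = g (ψ p) (X (ψ p)) (diff m n ψ p v))
    (q : M) (y : Model m) (hy : y ∈ (extChartAt (𝓡 m) q).target) :
    ContDiffAt ℝ ∞ (coordField T q) y := by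
  set Q := ψ ((extChartAt (𝓡 m) q).symm y) with hQdef
  have hQ : ψ ((extChartAt (𝓡 m) q).symm y) ∈ (extChartAt (𝓡 n) Q).source :=
    mem_extChartAt_source _
  have hQt := (extChartAt (𝓡 n) Q).map_source hQ
  have hh := contDiffAt_localRep hψ hy hQ
  have hB : ContDiffAt ℝ ∞ (fun z ↦ coordMetric g Q (localRep m n ψ q Q z)) y :=
    (hg Q (localRep m n ψ q Q y) hQt).comp y hh
  have hD : ContDiffAt ℝ ∞ (fderiv ℝ (localRep m n ψ q Q)) y := hh.fderiv_right (by simp)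
  have hXc : ContDiffAt ℝ ∞ (fun z ↦ coordField X Q (localRep m n ψ q Q z)) y :=
    (contDiffAt_coordField hX Q (y := localRep m n ψ q Q y) hQt).comp y hh
  have hθ : ContDiffAt ℝ ∞ (fun z ↦ (coordMetric g Q (localRep m n ψ q Q z)
      (coordField X Q (localRep m n ψ q Q z))).comp (fderiv ℝ (localRep m n ψ q Q) z)) y :=
    (hB.clm_apply hXc).clm_comp hD
  have hinv : ContDiffAt ℝ ∞ (fun z ↦ (coordMetric (inducedMetric (m := m) g ψ) q z).inverse) y :=
    ((hG.inner q y hy).isInvertible.contDiffAt_map_inverse).comp y (hG.smooth q y hy)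
  refine (hinv.clm_apply hθ).congr_of_eventuallyEq ?_
  filter_upwards [eventually_mem_source hψ hy hQ] with z hz
  refine (((hG.inner q z hz.1).isInvertible.inverse_apply_eq).2 ?_).symm
  ext v
  exact (coordMetric_tangentialPart hT hψ hz.1 hz.2 v).symm

end Immersion

/-! ### Second fundamental form and mean curvature vector -/

section SecondFundamentalForm

variable {m n : ℕ} {M : Type*} [TopologicalSpace M] [ChartedSpace (Model m) M]
  [IsManifold (𝓡 m) ∞ M] {N : Type*} [TopologicalSpace N] [ChartedSpace (Model n) N]
  [IsManifold (𝓡 n) ∞ N]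

/-- The value at `p` of a vector field along `ψ`, as an element of `ℝⁿ`. -/
def alongVal {ψ : M → N} (Y : ∀ p : M, TangentSpace (𝓡 n) (ψ p)) (p : M) : Model n := Y p

/-- The differential `dψ_p` as a linear map from `ℝᵐ` to `ℝⁿ`. -/
def diffL (m n : ℕ) {M : Type*} [TopologicalSpace M] [ChartedSpace (Model m) M]
    {N : Type*} [TopologicalSpace N] [ChartedSpace (Model n) N] (ψ : M → N) (p : M) :
    Model m →L[ℝ] Model n := diff m n ψ p

/-- The components of `dψ v` in a chart, for a vector `v` with given components. -/
theorem coframe_diffL {ψ : M → N} {q : M} {Q : N} {y : Model m} (hψ : ContMDiff (𝓡 m) (𝓡 n) ∞ ψ)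
    (hy : y ∈ (extChartAt (𝓡 m) q).target)
    (hQ : ψ ((extChartAt (𝓡 m) q).symm y) ∈ (extChartAt (𝓡 n) Q).source) (v : Model m) :
    coframe Q (ψ ((extChartAt (𝓡 m) q).symm y))
      (diffL m n ψ ((extChartAt (𝓡 m) q).symm y) (frame q y v)) =
    fderiv ℝ (localRep m n ψ q Q) y v := by
  have h1 : diffL m n ψ ((extChartAt (𝓡 m) q).symm y) (frame q y v) =
      frame Q (localRep m n ψ q Q y) (fderiv ℝ (localRep m n ψ q Q) y v) :=
    (mfderiv_comp_symm hψ hy v).symm.trans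
      (mfderiv_eq_frame_comp Q (contMDiffAt_comp_symm hψ hy) hQ v)
  have h2 := coframe_frame Q ((extChartAt (𝓡 n) Q).map_source hQ)
    (fderiv ℝ (localRep m n ψ q Q) y v)
  rw [(extChartAt (𝓡 n) Q).left_inv hQ] at h2
  rw [h1]
  exact h2

theorem diffL_center {ψ : M → N} (hψ : ContMDiff (𝓡 m) (𝓡 n) ∞ ψ) (p : M) :
    diffL m n ψ p = fderiv ℝ (localRep m n ψ p (ψ p)) (extChartAt (𝓡 m) p p) := by
  ext1 v
  have h := coframe_diffL (Q := ψ p) hψ (mem_extChartAt_target (I := 𝓡 m) p)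
    (by rw [extChartAt_to_inv]; exact mem_extChartAt_source _) v
  rw [extChartAt_to_inv, frame_self, coframe_self] at h
  exact h

omit [IsManifold (𝓡 m) ∞ M] [IsManifold (𝓡 n) ∞ N] in
theorem localRep_center (ψ : M → N) (p : M) :
    localRep m n ψ p (ψ p) (extChartAt (𝓡 m) p p) = extChartAt (𝓡 n) (ψ p) (ψ p) := by
  rw [localRep, extChartAt_to_inv]

/-- The covariant derivative along `ψ` at `p`, in terms of the components `yc` of the field in the
chart at `ψ p`. -/
theorem covDerivAlong_eq (g : BilinField n N) {ψ : M → N} (hψ : ContMDiff (𝓡 m) (𝓡 n) ∞ ψ)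
    (Y : ∀ p : M, TangentSpace (𝓡 n) (ψ p)) (p : M) {yc : Model m → Model n}
    (hY : ∀ᶠ x in 𝓝 p, coframe (ψ p) (ψ x) (alongVal Y x) = yc (extChartAt (𝓡 m) p x))
    (hyc : DifferentiableAt ℝ yc (extChartAt (𝓡 m) p p)) (v : Model m) :
    (covDerivAlong g ψ Y p v : Model n) = fderiv ℝ yc (extChartAt (𝓡 m) p p) v +
      christoffel (coordMetric g (ψ p)) (localRep m n ψ p (ψ p) (extChartAt (𝓡 m) p p))
        (fderiv ℝ (localRep m n ψ p (ψ p)) (extChartAt (𝓡 m) p p) v)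
        (yc (extChartAt (𝓡 m) p p)) := by
  have hp := mem_extChartAt_target (I := 𝓡 m) p
  have h1 : (covDerivAlong g ψ Y p v : Model n) = (coframe (ψ p) (ψ p)).inverse
      (diffAt (fun x ↦ coframe (ψ p) (ψ x) (alongVal Y x)) p v +
        christoffel (coordMetric g (ψ p)) (extChartAt (𝓡 n) (ψ p) (ψ p))
          (diffAt (fun x ↦ extChartAt (𝓡 n) (ψ p) (ψ x)) p v)
          (coframe (ψ p) (ψ p) (alongVal Y p))) := rfl
  have hmd : MDifferentiableAt (𝓡 m) 𝓘(ℝ, Model n)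
      (fun x ↦ yc (extChartAt (𝓡 m) p x)) p :=
    hyc.mdifferentiableAt.comp p ((contMDiffAt_extChartAt (n := ∞)).mdifferentiableAt (by simp))
  have hmd2 : MDifferentiableAt (𝓡 m) 𝓘(ℝ, Model n) (fun x ↦ extChartAt (𝓡 n) (ψ p) (ψ x)) p :=
    ((contMDiffAt_extChartAt (n := ∞)).comp p (hψ p)).mdifferentiableAt (by simp)
  have h2 : diffAt (fun x ↦ coframe (ψ p) (ψ x) (alongVal Y x)) p =
      fderiv ℝ yc (extChartAt (𝓡 m) p p) := by
    rw [diffAt_eq_fderiv (hmd.congr_of_eventuallyEq hY)]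
    refine Filter.EventuallyEq.fderiv_eq ?_
    have hc : Filter.Tendsto (extChartAt (𝓡 m) p).symm (𝓝 (extChartAt (𝓡 m) p p)) (𝓝 p) := by
      have := (contMDiffAt_extChartAt_symm p hp).continuousAt
      rwa [ContinuousAt, extChartAt_to_inv] at this
    filter_upwards [hc.eventually hY, (isOpen_extChartAt_target p).mem_nhds hp] with z hz hzt
    rw [hz, (extChartAt (𝓡 m) p).right_inv hzt]
  have h3 : diffAt (fun x ↦ extChartAt (𝓡 n) (ψ p) (ψ x)) p =
      fderiv ℝ (localRep m n ψ p (ψ p)) (extChartAt (𝓡 m) p p) := diffAt_eq_fderiv hmd2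
  rw [h1, h2, h3, hY.self_of_nhds, coframe_self, ContinuousLinearMap.inverse_id, localRep_center]
  rfl

/-- At `p`, in the preferred charts at `p` and `ψ p`, the second fundamental form is its coordinate
expression. -/
theorem secondFundamentalForm_eq (g : BilinField n N) {ψ : M → N}
    (hψ : ContMDiff (𝓡 m) (𝓡 n) ∞ ψ) (p : M) (v w : Model m) :
    (secondFundamentalForm g ψ p v w : Model n) =
      coordII (coordMetric (inducedMetric g ψ) p) (coordMetric g (ψ p))
        (localRep m n ψ p (ψ p)) (extChartAt (𝓡 m) p p) v w := by
  have hp := mem_extChartAt_target (I := 𝓡 m) p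
  have hps := mem_extChartAt_source (I := 𝓡 m) p
  have hQ : ψ ((extChartAt (𝓡 m) p).symm (extChartAt (𝓡 m) p p)) ∈
      (extChartAt (𝓡 n) (ψ p)).source := by
    rw [extChartAt_to_inv]; exact mem_extChartAt_source _
  let W : VField m M := FiberBundle.extend (x := p) (Model m) w
  have hW : ∀ x ∈ (extChartAt (𝓡 m) p).source, fieldVal W x = frame p (extChartAt (𝓡 m) p x) w := by
    intro x hx
    refine (extend_eq_chartField p w hx).trans ?_
    have h6 := chartField_symm p ((extChartAt (𝓡 m) p).map_source hx) w
    rwa [(extChartAt (𝓡 m) p).left_inv hx] at h6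
  have hh := contDiffAt_localRep hψ hp hQ
  have h1 := covDerivAlong_eq g hψ (fun x ↦ diff m n ψ x (W x)) p
    -- the components of `dψ W` are the partial derivatives of the coordinate expression of `ψ`
    (yc := fun z ↦ fderiv ℝ (localRep m n ψ p (ψ p)) z w) (by
      filter_upwards [(isOpen_extChartAt_source p).mem_nhds hps,
        hψ.continuous.continuousAt.preimage_mem_nhds
          ((isOpen_extChartAt_source (ψ p)).mem_nhds (mem_extChartAt_source (I := 𝓡 n) (ψ p)))]
        with x hx hx2
      have hxt := (extChartAt (𝓡 m) p).map_source hx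
      have h := coframe_diffL (Q := ψ p) hψ hxt
        (by rw [(extChartAt (𝓡 m) p).left_inv hx]; exact hx2) w
      rw [(extChartAt (𝓡 m) p).left_inv hx, ← hW x hx] at h
      exact h)
    (hasFDerivAt_fderiv_apply hh w).differentiableAt v
  have h2 := covDerivAlong_eq (inducedMetric (m := m) g ψ) (contMDiff_id (I := 𝓡 m) (M := M)) W p
    (yc := fun _ ↦ w) (by
      filter_upwards [(isOpen_extChartAt_source p).mem_nhds hps] with x hx
      have h := coframe_frame p ((extChartAt (𝓡 m) p).map_source hx) w
      rw [(extChartAt (𝓡 m) p).left_inv hx, ← hW x hx] at h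
      exact h)
    (differentiableAt_const _) v
  have hid : localRep m m (id : M → M) p p =ᶠ[𝓝 (extChartAt (𝓡 m) p p)] id := by
    filter_upwards [(isOpen_extChartAt_target p).mem_nhds hp] with z hz using
      (extChartAt (𝓡 m) p).right_inv hz
  have h3 : fderiv ℝ (localRep m m (id : M → M) p p) (extChartAt (𝓡 m) p p) =
      ContinuousLinearMap.id ℝ _ := by rw [hid.fderiv_eq, fderiv_id]
  have h4 : localRep m m (id : M → M) p p (extChartAt (𝓡 m) p p) = extChartAt (𝓡 m) p p :=
    hid.self_of_nhds
  rw [(hasFDerivAt_fderiv_apply hh w).fderiv] at h1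
  have h2' : (covDeriv (inducedMetric g ψ) W p v : Model m) =
      christoffel (coordMetric (inducedMetric g ψ) p) (extChartAt (𝓡 m) p p) v w := by
    refine Eq.trans h2 ?_
    change _ + christoffel (coordMetric (inducedMetric g ψ) p)
      (localRep m m (id : M → M) p p (extChartAt (𝓡 m) p p))
      (fderiv ℝ (localRep m m (id : M → M) p p) (extChartAt (𝓡 m) p p) v) w = _
    rw [h3, h4]
    simp
  refine congrArg₂ (fun a b : Model n ↦ a - b) h1 ?_
  rw [← diffL_center hψ p]
  exact congrArg (diffL m n ψ p) h2'

/-- Pairing the mean curvature vector with a fixed vector `z` gives the normalized trace of the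
bilinear form `C = g(II, z)`. -/
theorem form_meanCurvatureVector (g : BilinField n N) {ψ : M → N}
    (hψ : ContMDiff (𝓡 m) (𝓡 n) ∞ ψ) (p : M) (z : Model n)
    (C : Model m →L[ℝ] Model m →L[ℝ] ℝ)
    (hC : ∀ u v, C u v = formAt g (ψ p) (coordII (coordMetric (inducedMetric g ψ) p)
      (coordMetric g (ψ p)) (localRep m n ψ p (ψ p)) (extChartAt (𝓡 m) p p) u v) z) :
    formAt g (ψ p) (meanCurvatureVector (m := m) g ψ p) z =
      1 / m * bilinTrace (formAt (inducedMetric g ψ) p) C := by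
  have h1 : (meanCurvatureVector (m := m) g ψ p : Model n) = (1 / (m : ℝ)) •
      ∑ i, ∑ j, (gram (formAt (inducedMetric (m := m) g ψ) p))⁻¹ i j •
        coordII (coordMetric (inducedMetric g ψ) p) (coordMetric g (ψ p))
          (localRep m n ψ p (ψ p)) (extChartAt (𝓡 m) p p)
          (EuclideanSpace.single i 1) (EuclideanSpace.single j 1) := by
    have h2 : (Matrix.of fun k l ↦ inducedMetric g ψ p (coordVec p k) (coordVec p l)) =
        gram (formAt (inducedMetric (m := m) g ψ) p) := by
      ext k l
      rw [gram_apply]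
      rfl
    simp only [← secondFundamentalForm_eq g hψ, ← h2]
    rfl
  have h3 : formAt g (ψ p) (meanCurvatureVector (m := m) g ψ p) z = _ :=
    congrArg (fun a : Model n ↦ formAt g (ψ p) a z) h1
  rw [h3, bilinTrace_eq_sum]
  simp only [map_smul, map_sum, smul_apply, sum_apply, smul_eq_mul, hC]

end SecondFundamentalForm

/-! ### Orthogonal decomposition and traces -/

section Algebra

/-- A positive definite hyperplane and a timelike unit normal span the whole space. -/
theorem exists_decomposition {m : ℕ} (b : Model (m + 1) →L[ℝ] Model (m + 1) →L[ℝ] ℝ)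
    (f : Model m →L[ℝ] Model (m + 1))
    (hf : ∀ v, v ≠ 0 → 0 < b (f v) (f v)) {ν : Model (m + 1)} (hν : ∀ v, b ν (f v) = 0)
    (hν1 : b ν ν = -1) (x : Model (m + 1)) : ∃ (v : Model m) (c : ℝ), x = f v + c • ν := by
  let L : Model m × ℝ →ₗ[ℝ] Model (m + 1) :=
    f.toLinearMap.coprod (LinearMap.toSpanSingleton ℝ _ ν)
  have hL : ∀ v c, L (v, c) = f v + c • ν := fun v c ↦ rfl
  have hinj : Function.Injective L := by
    rw [injective_iff_map_eq_zero]
    rintro ⟨v, c⟩ h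
    rw [hL] at h
    have h1 : b ν (f v + c • ν) = 0 := by rw [h, map_zero]
    have hc : c = 0 := by simpa [hν, hν1] using h1
    subst hc
    have h2 : f v = 0 := by simpa using h
    have hv : v = 0 := by
      by_contra hv
      have := hf v hv
      simp [h2] at this
    rw [hv]; rfl
  have hsurj : Function.Surjective L :=
    (LinearMap.injective_iff_surjective_of_finrank_eq_finrank (by simp)).1 hinj
  obtain ⟨⟨v, c⟩, h⟩ := hsurj x
  exact ⟨v, c, by rw [← h, hL]⟩

theorem bilinTrace_self {m : ℕ} {B : Model m →L[ℝ] Model m →L[ℝ] ℝ} (hB : IsInner B) :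
    bilinTrace B B = m := by
  rw [bilinTrace, hB.gram_transpose,
    Matrix.nonsing_inv_mul _ hB.posDef_gram.det_pos.ne'.isUnit, Matrix.trace_one, Fintype.card_fin]

theorem bilinTrace_add {m : ℕ} (B C D : Model m →L[ℝ] Model m →L[ℝ] ℝ) :
    bilinTrace B (C + D) = bilinTrace B C + bilinTrace B D := by
  rw [bilinTrace, bilinTrace, bilinTrace, gram_add, Matrix.transpose_add, Matrix.mul_add,
    Matrix.trace_add]

theorem bilinTrace_smul {m : ℕ} (B C : Model m →L[ℝ] Model m →L[ℝ] ℝ) (c : ℝ) :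
    bilinTrace B (c • C) = c * bilinTrace B C := by
  rw [bilinTrace, bilinTrace, gram_smul, Matrix.transpose_smul, Matrix.mul_smul,
    Matrix.trace_smul, smul_eq_mul]

end Algebra

/-! ### The divergence of the tangential part of a conformal field -/

section Hypersurface

variable {m n : ℕ} {M : Type*} [TopologicalSpace M] [ChartedSpace (Model m) M]
  [IsManifold (𝓡 m) ∞ M] {N : Type*} [TopologicalSpace N] [ChartedSpace (Model n) N]
  [IsManifold (𝓡 n) ∞ N]

omit [IsManifold (𝓡 n) ∞ N] in
/-- The tangential part `T` of `X` exists, since the induced metric is nondegenerate. -/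
theorem exists_tangentialPart {g : BilinField n N} {X : VField n N} {ψ : M → N}
    (hG : IsSmoothRiemannian (inducedMetric (m := m) g ψ)) :
    ∃ T : VField m M, ∀ p v, inducedMetric g ψ p (T p) v = g (ψ p) (X (ψ p)) (diff m n ψ p v) := by
  have hinv : ∀ p, (formAt (inducedMetric (m := m) g ψ) p).IsInvertible := fun p ↦ by
    rw [← coordMetric_center]
    exact (hG.inner p _ (mem_extChartAt_target p)).isInvertible
  refine ⟨fun p ↦ (formAt (inducedMetric (m := m) g ψ) p).inverse
    ((formAt g (ψ p) (fieldVal X (ψ p))).comp (diffL m n ψ p)), fun p v ↦ ?_⟩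
  exact apply_inverse_apply (hinv p) _ v

/-- A Lorentzian metric is nondegenerate: a vector orthogonal to everything is orthogonal to a
timelike vector, hence spacelike or zero, and orthogonal to itself. -/
theorem IsLorentzianMetric.isInvertible_formAt {g : BilinField n N} (hg : IsLorentzianMetric g)
    (x : N) : (formAt g x).IsInvertible := by
  obtain ⟨v, -, hpos⟩ := hg.signature x
  refine isInvertible_of_nondegenerate fun u hu ↦ ?_
  by_contra h
  have h1 : formAt g x v u = 0 := (hg.symm x v u).trans (hu v)
  exact (hpos u h1 h).ne' (hu u)

theorem IsLorentzianMetric.contDiffAt_coordMetric {g : BilinField n N}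
    (hg : IsLorentzianMetric g) (q : N) (y : Model n) (hy : y ∈ (extChartAt (𝓡 n) q).target) :
    ContDiffAt ℝ ∞ (coordMetric g q) y :=
  SpacelikeHypersurface.contDiffAt_coordMetric hg.smooth q hy

variable {g : BilinField n N} {ψ : M → N}

theorem eventually_coordMetric_inducedMetric (hψ : ContMDiff (𝓡 m) (𝓡 n) ∞ ψ) (p : M) :
    ∀ᶠ z in 𝓝 (extChartAt (𝓡 m) p p), ∀ u v, coordMetric (inducedMetric (m := m) g ψ) p z u v =
      coordMetric g (ψ p) (localRep m n ψ p (ψ p) z)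
        (fderiv ℝ (localRep m n ψ p (ψ p)) z u) (fderiv ℝ (localRep m n ψ p (ψ p)) z v) := by
  have hQ : ψ ((extChartAt (𝓡 m) p).symm (extChartAt (𝓡 m) p p)) ∈
      (extChartAt (𝓡 n) (ψ p)).source := by
    rw [extChartAt_to_inv]; exact mem_extChartAt_source _
  filter_upwards [eventually_mem_source hψ (mem_extChartAt_target p) hQ] with z hz u v using
    coordMetric_inducedMetric g hψ hz.1 hz.2 u v

/-- The mean curvature vector is normal. -/
theorem form_meanCurvatureVector_diff (hg : IsLorentzianMetric g)
    (hψ : IsSpacelikeImmersion m g ψ) (p : M) (w : Model m) :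
    formAt g (ψ p) (meanCurvatureVector (m := m) g ψ p) (diffL m n ψ p w) = 0 := by
  have hG := isSmoothRiemannian_inducedMetric hg.contDiffAt_coordMetric hg.symm hψ
  have hp := mem_extChartAt_target (I := 𝓡 m) p
  have hQ : ψ ((extChartAt (𝓡 m) p).symm (extChartAt (𝓡 m) p p)) ∈
      (extChartAt (𝓡 n) (ψ p)).source := by
    rw [extChartAt_to_inv]; exact mem_extChartAt_source _
  have hc : localRep m n ψ p (ψ p) (extChartAt (𝓡 m) p p) = _ := localRep_center ψ p
  have hBd := (hg.contDiffAt_coordMetric (ψ p) _ (mem_extChartAt_target _)).differentiableAt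
    (by simp)
  have hBi := hg.isInvertible_formAt (ψ p)
  rw [← coordMetric_center] at hBi
  rw [← hc] at hBd hBi
  rw [form_meanCurvatureVector g hψ.smooth p _ 0]
  · simp [bilinTrace_eq_sum]
  intro u v
  have h := coordII_normal (eventually_coordMetric_inducedMetric (g := g) hψ.smooth p)
    ((hG.smooth p _ hp).differentiableAt (by simp)) hBd (contDiffAt_localRep hψ.smooth hp hQ)
    (fun z a b ↦ hg.symm _ _ _) (hG.inner p _ hp).isInvertible hBi u v w
  rw [diffL_center hψ.smooth, ← coordMetric_center, ← hc, h]
  simp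

/-- The divergence of the tangential part `T` of a conformal field `X` is `m (η + g(𝐇, X))`. -/
theorem divergence_tangentialPart (hm : 0 < m) (hg : IsLorentzianMetric g)
    (hψ : IsSpacelikeImmersion m g ψ) {X : VField n N} (hX : ∀ x, X.SmoothAt x) {η : N → ℝ}
    (hconf : IsConformalField g X η) {T : VField m M}
    (hT : ∀ p v, inducedMetric g ψ p (T p) v = g (ψ p) (X (ψ p)) (diff m n ψ p v)) (p : M) :
    divergence (inducedMetric g ψ) T p =
      m * (η (ψ p) + formAt g (ψ p) (meanCurvatureVector (m := m) g ψ p) (fieldVal X (ψ p))) := by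
  have hG := isSmoothRiemannian_inducedMetric hg.contDiffAt_coordMetric hg.symm hψ
  have hp := mem_extChartAt_target (I := 𝓡 m) p
  have hQ : ψ ((extChartAt (𝓡 m) p).symm (extChartAt (𝓡 m) p p)) ∈
      (extChartAt (𝓡 n) (ψ p)).source := by
    rw [extChartAt_to_inv]; exact mem_extChartAt_source _
  have hc : localRep m n ψ p (ψ p) (extChartAt (𝓡 m) p p) = _ := localRep_center ψ p
  have hQt := mem_extChartAt_target (I := 𝓡 n) (ψ p)
  have hBd := (hg.contDiffAt_coordMetric (ψ p) _ hQt).differentiableAt (by simp)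
  have hXd := (contDiffAt_coordField hX (ψ p) hQt).differentiableAt (by simp)
  have hBi := hg.isInvertible_formAt (ψ p)
  have hXc := hconf.lieTensor_center hg.contDiffAt_coordMetric (ψ p)
  rw [← coordMetric_center] at hBi
  rw [← hc] at hBd hBi hXd hXc
  have ht : ∀ᶠ z in 𝓝 (extChartAt (𝓡 m) p p), ∀ v,
      coordMetric (inducedMetric (m := m) g ψ) p z (coordField T p z) v =
      coordMetric g (ψ p) (localRep m n ψ p (ψ p) z)
        (coordField X (ψ p) (localRep m n ψ p (ψ p) z))
        (fderiv ℝ (localRep m n ψ p (ψ p)) z v) := by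
    filter_upwards [eventually_mem_source hψ.smooth hp hQ] with z hz v using
      coordMetric_tangentialPart hT hψ.smooth hz.1 hz.2 v
  have h1 := lieTensor_tangentialPart (eventually_coordMetric_inducedMetric (g := g) hψ.smooth p)
    ht hXc ((hG.smooth p _ hp).differentiableAt (by simp)) hBd
    (contDiffAt_localRep hψ.smooth hp hQ)
    ((contDiffAt_tangentialPart hg.contDiffAt_coordMetric hψ.smooth hG hX hT p _
      hp).differentiableAt (by simp)) hXd
    (fun z a b ↦ hg.symm _ _ _) (hG.inner p _ hp).isInvertible hBi
  rw [hc] at h1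
  -- `½ 𝓛_T g - η g` is the bilinear form `g(II, X)`
  set L := lieTensor (coordMetric (inducedMetric g ψ) p) (coordField T p) (extChartAt (𝓡 m) p p)
    with hL
  have hin : IsInner (formAt (inducedMetric (m := m) g ψ) p) := by
    rw [← coordMetric_center]
    exact hG.inner p _ hp
  rw [coordMetric_center, coordMetric_center, coordField_center] at h1
  rw [form_meanCurvatureVector g hψ.smooth p _
    ((1 / 2 : ℝ) • L + (-η (ψ p)) • formAt (inducedMetric (m := m) g ψ) p) fun u v ↦ by
      simp only [add_apply, smul_apply, smul_eq_mul, h1]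
      ring]
  rw [bilinTrace_add, bilinTrace_smul, bilinTrace_smul, bilinTrace_self hin, divergence, coordDiv,
    coordMetric_center, ← hL]
  have hm' : (m : ℝ) ≠ 0 := by positivity
  field_simp
  ring

end Hypersurface

end SpacelikeHypersurface

end

open SpacelikeHypersurface in
theorem theorem3p3 {m : ℕ} (hm : 0 < m)
    {Mbar : Type*} [TopologicalSpace Mbar] [T2Space Mbar]
    [ChartedSpace (SpacelikeHypersurface.Model (m + 1)) Mbar] [IsManifold (𝓡 (m + 1)) ∞ Mbar]
    (gbar : SpacelikeHypersurface.BilinField (m + 1) Mbar)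
    (hg : SpacelikeHypersurface.IsLorentzianMetric gbar)
    (X : SpacelikeHypersurface.VField (m + 1) Mbar) (hX : ∀ x, X.SmoothAt x)
    (hXtime : ∀ x, gbar x (X x) (X x) < 0)
    (η : Mbar → ℝ) (hη : ContMDiff (𝓡 (m + 1)) 𝓘(ℝ, ℝ) ∞ η) (hηpos : ∀ x, 0 < η x)
    (hconf : SpacelikeHypersurface.IsConformalField gbar X η)
    {M : Type*} [TopologicalSpace M] [T2Space M] [CompactSpace M]
    [ChartedSpace (SpacelikeHypersurface.Model m) M] [IsManifold (𝓡 m) ∞ M]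
    (ψ : M → Mbar) (hψ : SpacelikeHypersurface.IsSpacelikeImmersion m gbar ψ)
    (hH : ∀ p : M, η (ψ p) / √(-gbar (ψ p) (X (ψ p)) (X (ψ p)))
      ≤ SpacelikeHypersurface.meanCurvature (m := m) gbar X ψ p) :
    (∀ (p : M) (v : TangentSpace (𝓡 m) p),
      gbar (ψ p) (X (ψ p)) (SpacelikeHypersurface.diff m (m + 1) ψ p v) = 0) ∧
    ∀ p : M, SpacelikeHypersurface.meanCurvature (m := m) gbar X ψ p
      = η (ψ p) / √(-gbar (ψ p) (X (ψ p)) (X (ψ p))) := by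
  have hG := isSmoothRiemannian_inducedMetric hg.contDiffAt_coordMetric hg.symm hψ
  obtain ⟨T, hT⟩ := exists_tangentialPart (X := X) hG
  -- pointwise decomposition of `X` and `𝐇` into tangential and normal parts
  have key : ∀ p : M, ∃ (t : Model m) (ν : Model (m + 1)) (a : ℝ),
      fieldVal X (ψ p) = diffL m (m + 1) ψ p t + a • ν ∧
      (∀ v, formAt gbar (ψ p) ν (diffL m (m + 1) ψ p v) = 0) ∧ formAt gbar (ψ p) ν ν = -1 ∧
      0 < a ∧ formAt gbar (ψ p) (meanCurvatureVector (m := m) gbar ψ p) (fieldVal X (ψ p)) =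
        -(meanCurvature (m := m) gbar X ψ p * a) := by
    intro p
    have hν := futureUnitNormal_spec hg hXtime hψ p
    obtain ⟨ν, hn, hu, hf, hH⟩ : ∃ ν : Model (m + 1),
        (∀ v, formAt gbar (ψ p) ν (diffL m (m + 1) ψ p v) = 0) ∧ formAt gbar (ψ p) ν ν = -1 ∧
        formAt gbar (ψ p) ν (fieldVal X (ψ p)) < 0 ∧ meanCurvature (m := m) gbar X ψ p =
          -formAt gbar (ψ p) (meanCurvatureVector (m := m) gbar ψ p) ν :=
      ⟨futureUnitNormal m gbar X ψ p, hν.normal, hν.unit, hν.future, rfl⟩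
    obtain ⟨t, a, hta⟩ := exists_decomposition (formAt gbar (ψ p)) (diffL m (m + 1) ψ p)
      (fun v hv ↦ hψ.spacelike p v hv) hn hu (fieldVal X (ψ p))
    have hz : ∀ z : Model (m + 1), (∀ v, formAt gbar (ψ p) z (diffL m (m + 1) ψ p v) = 0) →
        formAt gbar (ψ p) z (fieldVal X (ψ p)) = a * formAt gbar (ψ p) z ν := fun z hz ↦ by
      rw [hta, map_add, map_smul, hz, zero_add, smul_eq_mul]
    refine ⟨t, ν, a, hta, hn, hu, ?_, ?_⟩
    · rw [hz ν hn, hu] at hf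
      linarith
    · rw [hz _ (form_meanCurvatureVector_diff hg hψ p), hH]
      ring
  -- `X` has length `√(a² - |t|²) ≤ a`
  have hnorm : ∀ p : M, ∀ {t : Model m} {ν : Model (m + 1)} {a : ℝ},
      fieldVal X (ψ p) = diffL m (m + 1) ψ p t + a • ν →
      (∀ v, formAt gbar (ψ p) ν (diffL m (m + 1) ψ p v) = 0) → formAt gbar (ψ p) ν ν = -1 →
      -gbar (ψ p) (X (ψ p)) (X (ψ p)) = a ^ 2 -
        formAt gbar (ψ p) (diffL m (m + 1) ψ p t) (diffL m (m + 1) ψ p t) := by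
    intro p t ν a h1 h2 h3
    have h4 : formAt gbar (ψ p) (diffL m (m + 1) ψ p t) ν = 0 := (hg.symm _ _ _).trans (h2 t)
    have h5 : gbar (ψ p) (X (ψ p)) (X (ψ p)) =
      formAt gbar (ψ p) (fieldVal X (ψ p)) (fieldVal X (ψ p)) := rfl
    rw [h5, h1]
    simp only [map_add, map_smul, add_apply, smul_apply, smul_eq_mul, h2, h3, h4]
    ring
  have hnonneg : ∀ (p : M) (t : Model m),
      0 ≤ formAt gbar (ψ p) (diffL m (m + 1) ψ p t) (diffL m (m + 1) ψ p t) := by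
    intro p t
    by_cases h : t = 0
    · simp [h]
    · exact (hψ.spacelike p t h).le
  have hm' : (0 : ℝ) < m := Nat.cast_pos.2 hm
  have hdiv := divergence_tangentialPart hm hg hψ hX hconf hT
  have hzero := divergence_eq_zero hG
    (contDiffAt_tangentialPart hg.contDiffAt_coordMetric hψ.smooth hG hX hT) (fun p ↦ by
      obtain ⟨t, ν, a, h1, h2, h3, ha, h4⟩ := key p
      have h5 := hnorm p h1 h2 h3
      have h6 : √(-gbar (ψ p) (X (ψ p)) (X (ψ p))) ≤ a := by
        rw [h5]
        exact Real.sqrt_le_iff.2 ⟨ha.le, by linarith [hnonneg p t]⟩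
      have h7 : 0 < √(-gbar (ψ p) (X (ψ p)) (X (ψ p))) :=
        Real.sqrt_pos.2 (by linarith [hXtime (ψ p)])
      have h8 := (div_le_iff₀ h7).1 (hH p)
      have h9 : 0 ≤ meanCurvature (m := m) gbar X ψ p :=
        (div_nonneg (hηpos _).le h7.le).trans (hH p)
      rw [hdiv, h4]
      refine mul_nonpos_of_nonneg_of_nonpos hm'.le ?_
      linarith [mul_le_mul_of_nonneg_left h6 h9])
  -- equality in the chain of inequalities forces `t = 0`
  have hfin : ∀ p : M, (∀ v, formAt gbar (ψ p) (fieldVal X (ψ p)) (diffL m (m + 1) ψ p v) = 0) ∧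
      meanCurvature (m := m) gbar X ψ p = η (ψ p) / √(-gbar (ψ p) (X (ψ p)) (X (ψ p))) := by
    intro p
    obtain ⟨t, ν, a, h1, h2, h3, ha, h4⟩ := key p
    have h5 := hnorm p h1 h2 h3
    have h7 : 0 < √(-gbar (ψ p) (X (ψ p)) (X (ψ p))) :=
      Real.sqrt_pos.2 (by linarith [hXtime (ψ p)])
    have h8 := (div_le_iff₀ h7).1 (hH p)
    have h9 : 0 < meanCurvature (m := m) gbar X ψ p := (div_pos (hηpos _) h7).trans_le (hH p)
    have h10 : η (ψ p) = meanCurvature (m := m) gbar X ψ p * a := by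
      have := (mul_eq_zero.1 ((hdiv p).symm.trans (hzero p))).resolve_left hm'.ne'
      rw [h4] at this
      linarith
    rw [h10] at h8
    have h11 := le_of_mul_le_mul_left h8 h9
    have h12 : t = 0 := by
      by_contra h
      have h13 : 0 < formAt gbar (ψ p) (diffL m (m + 1) ψ p t) (diffL m (m + 1) ψ p t) :=
        hψ.spacelike p t h
      have h14 := (Real.le_sqrt ha.le (by linarith [hXtime (ψ p)])).1 h11
      linarith
    subst h12
    rw [map_zero, zero_add] at h1
    refine ⟨fun v ↦ by rw [h1, map_smul, smul_apply, h2, smul_zero], ?_⟩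
    rw [h10, h5, map_zero, map_zero, sub_zero, Real.sqrt_sq ha.le, mul_div_cancel_right₀ _ ha.ne']
  exact ⟨fun p ↦ (hfin p).1, fun p ↦ (hfin p).2⟩
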